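/- **Theorem 2.** Let $n$ be the number of products, let item $0$ be the no-purchase alternative, and let $\theta^*=(\theta_0^*,\dots,\theta_n^*)\in\mathbb{R}^{n+1}$ with $\theta_0^*=0$ be the vector of true log-preference scores, with bounded condition number: $\max_i e^{\theta_i^*}/\min_i e^{\theta_i^*}\le\kappa$ (where $i$ ranges over $0,\dots,n$). Each of the $2^n$ offer sets $S\subseteq\{1,\dots,n\}$ is selected independently with probability $p\in[0,1]$; let $\mathcal{E}$ be the random collection of selected sets. For each $S\in\mathcal{E}$ one observes $L\ge 1$ independent choices, each equal to item $j\in S\cup\{0\}$ with probability $e^{\theta_j^*}/(1+\sum_{i\in S}e^{\theta_i^*})$; all choices are independent of each other and of the selection. Let $x_S^{(i)}$ be the fraction of the $L$ choices at $S$ equal to $i$, let $$\mathcal{L}(\theta)=-\sum_{S\in\mathcal{E}}\Big\{\sum_{i\in S}x_S^{(i)}\theta_i-\log\Big(1+\sum_{i\in S}e^{\theta_i}\Big)\Big\},$$ and, for $\lambda>0$, let $\hat\theta$ be the penalized maximum likelihood estimator, i.e. the minimizer of $$\mathcal{L}(\theta)+\frac{\lambda}{2}\sum_{i=0}^n(\theta_i-\bar\theta)^2,\qquad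 \bar\theta=\frac{1}{n+1}\sum_{i=0}^n\theta_i,$$ over all $\theta\in\mathbb{R}^{n+1}$ with $\theta_0=0$. For all real $\kappa$ and $0<a\le b$ there are constants $C,c,K,M>0$, depending only on $\kappa,a,b$, such that the following holds for all integers $n\ge1$, $L\ge 1$ and all $p,\theta^*,\lambda$ as above. If $$a\sqrt{\frac{2^n p\log n}{nL}}\le\lambda\le b\sqrt{\frac{2^n p\log n}{nL}},\qquad 2^n p\ge C\,n\log n,\qquad n\sqrt{\frac{\log n}{2^n p L}}\le c,$$ then $\hat\theta$ exists and is unique for every realization of the data, and with probability at least $1-M n^{-10}$, $$\|\hat\theta-\theta^*\|_2\le K\,n\sqrt{\frac{\log n}{2^n p L}}.$$ -/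

import Mathlib

open MeasureTheory

namespace MNL

noncomputable section

/-- Score vectors `θ = (θ_0, θ_1, …, θ_n)` with the Euclidean norm. Index `0` is the no-purchase
alternative and the product `i : Fin n` is the item `i.succ`. -/
abbrev Score (n : ℕ) : Type := EuclideanSpace ℝ (Fin (n + 1))

/-- An offer set is a set of products. -/
abbrev OfferSet (n : ℕ) : Type := Finset (Fin n)

/-- The items a customer can choose from when `S` is offered: `S` and the no-purchase
alternative. -/
def available {n : ℕ} (S : OfferSet n) : Finset (Fin (n + 1)) :=
  insert 0 (S.map (Fin.succEmb n))

/-- The condition number `max_i exp θ_i / min_i exp θ_i`. -/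
def condNumber {n : ℕ} (θ : Score n) : ℝ :=
  (⨆ i, Real.exp (θ i)) / (⨅ i, Real.exp (θ i))

/-- The multinomial logit probability of choosing item `j` when `S` is offered. For `θ 0 = 0` the
denominator is `1 + ∑ i ∈ S, exp θ_i`. -/
def choiceProb {n : ℕ} (θ : Score n) (S : OfferSet n) (j : Fin (n + 1)) : ℝ :=
  if j ∈ available S then Real.exp (θ j) / ∑ i ∈ available S, Real.exp (θ i) else 0

theorem choiceProb_nonneg {n : ℕ} (θ : Score n) (S : OfferSet n) (j : Fin (n + 1)) :
    0 ≤ choiceProb θ S j := by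
  unfold choiceProb
  split_ifs
  · positivity
  · exact le_rfl

theorem sum_choiceProb {n : ℕ} (θ : Score n) (S : OfferSet n) :
    ∑ j, choiceProb θ S j = 1 := by
  have hpos : 0 < ∑ i ∈ available S, Real.exp (θ i) :=
    Finset.sum_pos (fun i _ => Real.exp_pos _) ⟨0, Finset.mem_insert_self _ _⟩
  unfold choiceProb
  rw [Finset.sum_ite_mem, Finset.univ_inter, ← Finset.sum_div, div_self hpos.ne']

/-- The law of a single customer's choice when `S` is offered. -/
def choiceLaw {n : ℕ} (θ : Score n) (S : OfferSet n) : PMF (Fin (n + 1)) :=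
  PMF.ofFintype (fun j => ENNReal.ofReal (choiceProb θ S j)) (by
    rw [← ENNReal.ofReal_sum_of_nonneg (fun j _ => choiceProb_nonneg θ S j), sum_choiceProb,
      ENNReal.ofReal_one])

/-- The sample space. The first component says for each offer set whether it is selected, the
second one gives the choices of the `L` customers for each offer set. The choices at an offer set
that is not selected are never looked at. -/
abbrev Sample (n L : ℕ) : Type :=
  (OfferSet n → Bool) × (OfferSet n → Fin L → Fin (n + 1))

/-- The law of the data: every offer set is selected with probability `p`, every choice at the
offer set `S` follows the multinomial logit law with score `θ`, and all these are independent. -/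
def dataLaw (n L : ℕ) (p : unitInterval) (θ : Score n) : Measure (Sample n L) :=
  (Measure.pi fun _ : OfferSet n => ProbabilityTheory.bernoulliMeasure true false p).prod
    (Measure.pi fun S : OfferSet n => Measure.pi fun _ : Fin L => (choiceLaw θ S).toMeasure)

instance (n L : ℕ) (p : unitInterval) (θ : Score n) :
    IsProbabilityMeasure (dataLaw n L p θ) := by
  unfold dataLaw
  infer_instance

/-- The set of selected offer sets. -/
def selected {n L : ℕ} (x : Sample n L) : Finset (OfferSet n) :=
  Finset.univ.filter fun S => x.1 S = true

/-- The fraction of the `L` customers who choose item `i` when `S` is offered. -/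
def freq {n L : ℕ} (x : Sample n L) (S : OfferSet n) (i : Fin (n + 1)) : ℝ :=
  (1 / (L : ℝ)) * ∑ l : Fin L, if x.2 S l = i then 1 else 0

/-- The (normalized) negative log-likelihood on the selected offer sets. -/
def negLogLik {n L : ℕ} (x : Sample n L) (θ : Score n) : ℝ :=
  -∑ S ∈ selected x,
    (∑ i ∈ S, freq x S i.succ * θ i.succ - Real.log (1 + ∑ i ∈ S, Real.exp (θ i.succ)))

/-- The mean `(n + 1)⁻¹ ∑_i θ_i` over all items, the no-purchase alternative included. -/
def mean {n : ℕ} (θ : Score n) : ℝ := (∑ i, θ i) / ((n : ℝ) + 1)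

/-- The negative log-likelihood with the sample-variance penalty. -/
def penalizedLoss {n L : ℕ} (lam : ℝ) (x : Sample n L) (θ : Score n) : ℝ :=
  negLogLik x θ + lam / 2 * ∑ i, (θ i - mean θ) ^ 2

/-- `θ` minimizes the penalized loss over all score vectors with vanishing `0`-th coordinate. -/
def IsPenalizedMLE {n L : ℕ} (lam : ℝ) (x : Sample n L) (θ : Score n) : Prop :=
  θ 0 = 0 ∧ ∀ η : Score n, η 0 = 0 → penalizedLoss lam x θ ≤ penalizedLoss lam x η

end

end MNL

/-!
The proof works in the shift-invariant form of the model. Put `d = θ̂ - θ*`, let `N = 2 ^ n * p`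
and `τ = √(N log n / (n L))`, and split `d` into its mean `m` and its centred part, whose squared
norm is `spread d`. Then `‖d‖² = spread d + (n + 1) m²`, and the two parts are bounded
separately; strong convexity alone would lose a factor `√n` in the direction of the mean.

*Randomness.* All estimates are tail bounds for sums of independent centred indicators, with a
Bernstein-type moment generating function (`HasBernsteinMGF`). They give `IsGoodSample`: every pair
of items is jointly available in at least `N / 8` selected sets, at most `2 N` sets are selected,
at most `N / n²` of them have fewer than `n / 4` products, and each coordinate of the gradient of
the likelihood at `θ*` (`noise`) is `O(τ)`. Small sets are handled by Markov's inequality, because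
they are an exponentially small fraction of all sets; the noise is handled conditionally on the
selection, its variance proxy being `∑ choiceProb = O(N / n)` over the selected sets.

*Centred part.* Jointly available pairs give a curvature of order `N / n` on centred vectors: the
variance of `d` under the choice probabilities is a sum over pairs, each with weight at least of
order `n⁻²`, so the count of sets containing a given pair suffices and no matrix concentration is
needed. With the gradient bound and convexity of the penalized loss along segments this gives
`√(spread d) = O(n^{3/2} τ / N)` (`IsGoodSample.sqrt_spread_sub_le`). The upper bound on `n √(log n
/ (N L))` makes this radius at most `1 / 2`, where the quadratic lower bound for log-sum-exp
applies.

*Mean.* The stationarity of the penalized loss in the direction `(0, 1, …, 1)` is an equation for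
the no-purchase probabilities alone. To first order these change by a multiple of `m` of total
weight at least of order `N / n`, up to a remainder bounded by `∑ 1 / (|S| + 1)² * ∑ |d i - m|`,
which yields `√n |m| = O(n^{3/2} τ / N)` (`IsGoodSample.abs_mean_sub_le`).

Existence and uniqueness hold because the likelihood part is convex and nonnegative and the penalty
is a positive definite quadratic form on vectors with vanishing `0`-th coordinate.
-/

namespace MNL

/-! ### Bernstein-type moment generating functions -/

/-- `X` satisfies `𝔼 exp (s X) ≤ exp (s² v)` for `|s| ≤ 1`; integrability is part of the
definition, as otherwise the integral could be `0`. Here `v` plays the role of a variance. -/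
def HasBernsteinMGF {Ω : Type*} [MeasurableSpace Ω] (X : Ω → ℝ) (v : ℝ) (ν : Measure Ω) : Prop :=
  ∀ s : ℝ, |s| ≤ 1 →
    Integrable (fun ω => Real.exp (s * X ω)) ν ∧ ∫ ω, Real.exp (s * X ω) ∂ν ≤ Real.exp (s ^ 2 * v)

namespace HasBernsteinMGF

variable {Ω : Type*} [MeasurableSpace Ω] {ν : Measure Ω} {X : Ω → ℝ} {v w : ℝ}

theorem neg (h : HasBernsteinMGF X v ν) : HasBernsteinMGF (fun ω => -X ω) v ν := by
  intro s hs
  simpa using h (-s) (by simpa using hs)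

theorem mono (h : HasBernsteinMGF X v ν) (hvw : v ≤ w) : HasBernsteinMGF X w ν := fun s hs =>
  ⟨(h s hs).1, (h s hs).2.trans (by gcongr)⟩

theorem measureReal_ge_le [IsFiniteMeasure ν] (h : HasBernsteinMGF X v ν) {s : ℝ} (hs0 : 0 ≤ s)
    (hs1 : s ≤ 1) (t : ℝ) : ν.real {ω | t ≤ X ω} ≤ Real.exp (-s * t + s ^ 2 * v) := by
  have hs : |s| ≤ 1 := abs_le.2 ⟨by linarith, hs1⟩
  refine (ProbabilityTheory.measure_ge_le_exp_mul_mgf t hs0 (h s hs).1).trans ?_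
  rw [Real.exp_add]
  exact mul_le_mul_of_nonneg_left (h s hs).2 (Real.exp_pos _).le

theorem measureReal_abs_ge_le [IsFiniteMeasure ν] (h : HasBernsteinMGF X v ν) {s : ℝ}
    (hs0 : 0 ≤ s) (hs1 : s ≤ 1) (t : ℝ) :
    ν.real {ω | t ≤ |X ω|} ≤ 2 * Real.exp (-s * t + s ^ 2 * v) := by
  have h1 : {ω | t ≤ |X ω|} = {ω | t ≤ X ω} ∪ {ω | t ≤ -X ω} := by
    ext ω
    simp [le_abs]
  rw [h1, two_mul]
  exact (measureReal_union_le _ _).trans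
    (add_le_add (h.measureReal_ge_le hs0 hs1 t) (h.neg.measureReal_ge_le hs0 hs1 t))

/-- A centred indicator of an event of probability `q` has variance proxy `q` (and not merely a
constant), which is what makes the bounds sharp for rare events. -/
theorem indicator_sub [IsProbabilityMeasure ν] {A : Set Ω} (hA : MeasurableSet A) :
    HasBernsteinMGF (fun ω => A.indicator (fun _ => (1 : ℝ)) ω - ν.real A) (ν.real A) ν := by
  intro s hs
  set q := ν.real A with hq
  have hq0 : 0 ≤ q := measureReal_nonneg
  have hq1 : q ≤ 1 := measureReal_le_one
  have hind : Integrable (A.indicator (fun _ => (1 : ℝ))) ν :=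
    (integrable_const (1 : ℝ)).indicator hA
  -- the exponential is an affine function of the indicator, which takes only two values
  have haff : ∀ ω, Real.exp (s * (A.indicator (fun _ => (1 : ℝ)) ω - q)) =
      Real.exp (s * (0 - q)) + A.indicator (fun _ => (1 : ℝ)) ω *
        (Real.exp (s * (1 - q)) - Real.exp (s * (0 - q))) := by
    intro ω
    by_cases h : ω ∈ A <;> simp [h]
  have hint : Integrable (fun ω => Real.exp (s * (A.indicator (fun _ => (1 : ℝ)) ω - q))) ν := by
    simp_rw [haff]
    exact (integrable_const _).add (hind.mul_const _)
  refine ⟨hint, ?_⟩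
  simp_rw [haff]
  rw [integral_add (integrable_const _) (hind.mul_const _), integral_mul_const,
    integral_indicator hA]
  simp only [integral_const, probReal_univ, smul_eq_mul, one_mul, mul_one,
    measureReal_restrict_apply, MeasurableSet.univ, Set.univ_inter, ← hq]
  have key : ∀ x : ℝ, |x| ≤ 1 → Real.exp (s * x) ≤ 1 + s * x + s ^ 2 * x ^ 2 := by
    intro x hx
    have hsx : |s * x| ≤ 1 := by
      rw [abs_mul]; exact mul_le_one₀ hs (abs_nonneg _) hx
    have := (abs_le.1 (Real.abs_exp_sub_one_sub_id_le hsx)).2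
    nlinarith
  have h1 := key (1 - q) (abs_le.2 ⟨by linarith, by linarith⟩)
  have h0 := key (0 - q) (abs_le.2 ⟨by linarith, by linarith⟩)
  have h2 : Real.exp (s * (0 - q)) + q * (Real.exp (s * (1 - q)) - Real.exp (s * (0 - q))) ≤
      1 + s ^ 2 * (q * (1 - q)) := by
    nlinarith [mul_le_mul_of_nonneg_left h1 hq0,
      mul_le_mul_of_nonneg_left h0 (sub_nonneg.2 hq1)]
  have h3 : s ^ 2 * (q * (1 - q)) ≤ s ^ 2 * q :=
    mul_le_mul_of_nonneg_left (by nlinarith) (sq_nonneg s)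
  linarith [Real.add_one_le_exp (s ^ 2 * q)]

theorem sum_pi {ι : Type*} [Fintype ι] {α : ι → Type*} [∀ i, MeasurableSpace (α i)]
    {μ : ∀ i, Measure (α i)} [∀ i, IsProbabilityMeasure (μ i)] {Y : ∀ i, α i → ℝ} {v : ι → ℝ}
    (J : Finset ι) (h : ∀ i ∈ J, HasBernsteinMGF (Y i) (v i) (μ i)) :
    HasBernsteinMGF (fun ω : ∀ i, α i => ∑ i ∈ J, Y i (ω i)) (∑ i ∈ J, v i) (Measure.pi μ) := by
  classical
  intro s hs
  have hexp : ∀ ω : ∀ i, α i, Real.exp (s * ∑ i ∈ J, Y i (ω i)) =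
      ∏ i, (if i ∈ J then Real.exp (s * Y i (ω i)) else 1) := by
    intro ω
    rw [Finset.mul_sum, Real.exp_sum, Finset.prod_ite_mem, Finset.univ_inter]
  have hi : ∀ i, Integrable (fun a => if i ∈ J then Real.exp (s * Y i a) else 1) (μ i) := by
    intro i
    by_cases hiJ : i ∈ J
    · simpa [hiJ] using (h i hiJ s hs).1
    · simp [hiJ]
  simp_rw [hexp]
  refine ⟨Integrable.fintype_prod_dep
    (f := fun i a => if i ∈ J then Real.exp (s * Y i a) else 1) hi, ?_⟩
  rw [integral_fintype_prod_eq_prod (fun i a => if i ∈ J then Real.exp (s * Y i a) else 1),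
    Finset.mul_sum, Real.exp_sum, ← Finset.univ_inter J, ← Finset.prod_ite_mem]
  refine Finset.prod_le_prod (fun i _ => integral_nonneg fun a => ?_) fun i _ => ?_
  · dsimp only [Pi.zero_apply]
    split_ifs
    · exact (Real.exp_pos _).le
    · exact zero_le_one
  · by_cases hiJ : i ∈ J
    · simpa [hiJ] using (h i hiJ s hs).2
    · simp [hiJ]

end HasBernsteinMGF

/-! ### Tangent inequalities for log-sum-exp -/

theorem one_add_add_sq_div_four_le_exp {x : ℝ} (hx : |x| ≤ 1) :
    1 + x + x ^ 2 / 4 ≤ Real.exp x := by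
  have h := Real.exp_bound hx (n := 3) (by norm_num)
  have h3 : |x| ^ 3 ≤ x ^ 2 := by
    rw [← sq_abs x]
    nlinarith [abs_nonneg x, sq_nonneg |x|]
  simp [Finset.sum_range_succ, Nat.factorial] at h
  have h1 := (abs_le.1 h).1
  norm_num at h1
  nlinarith [sq_nonneg x]

section Weighted

variable {ι : Type*} [Fintype ι] {w d : ι → ℝ}

/-- Jensen's inequality for `exp` in logarithmic form. -/
theorem sum_mul_le_log_sum_mul_exp (hw : ∀ i, 0 ≤ w i) (hw1 : ∑ i, w i = 1) :
    ∑ i, w i * d i ≤ Real.log (∑ i, w i * Real.exp (d i)) := by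
  set m := ∑ i, w i * d i with hm
  have h : Real.exp m ≤ ∑ i, w i * Real.exp (d i) := by
    have h1 : ∀ i, w i * (Real.exp m * (1 + (d i - m))) ≤ w i * Real.exp (d i) := by
      intro i
      refine mul_le_mul_of_nonneg_left ?_ (hw i)
      calc Real.exp m * (1 + (d i - m)) ≤ Real.exp m * Real.exp (d i - m) := by
            gcongr
            linarith [Real.add_one_le_exp (d i - m)]
        _ = Real.exp (d i) := by rw [← Real.exp_add]; ring_nf
    refine le_trans (le_of_eq ?_) (Finset.sum_le_sum fun i _ => h1 i)
    have h2 : ∀ i, w i * (Real.exp m * (1 + (d i - m))) =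
        Real.exp m * (w i * d i + (1 - m) * w i) := fun i => by ring
    simp_rw [h2]
    rw [← Finset.mul_sum, Finset.sum_add_distrib, ← Finset.mul_sum, hw1, ← hm]
    ring
  calc m = Real.log (Real.exp m) := (Real.log_exp m).symm
    _ ≤ _ := Real.log_le_log (Real.exp_pos m) h

theorem sum_mul_sub_sq_eq (hw1 : ∑ i, w i = 1) :
    ∑ i, w i * (d i - ∑ j, w j * d j) ^ 2 =
      1 / 2 * ∑ i, ∑ j, w i * w j * (d i - d j) ^ 2 := by
  set m := ∑ j, w j * d j with hm
  have h1 : ∀ i, ∑ j, w i * w j * (d i - d j) ^ 2 =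
      w i * d i ^ 2 - 2 * m * (w i * d i) + w i * ∑ j, w j * d j ^ 2 := by
    intro i
    have : ∀ j, w i * w j * (d i - d j) ^ 2 =
        w i * d i ^ 2 * w j - 2 * (w i * d i) * (w j * d j) + w i * (w j * d j ^ 2) :=
      fun j => by ring
    simp_rw [this]
    rw [Finset.sum_add_distrib, Finset.sum_sub_distrib, ← Finset.mul_sum, ← Finset.mul_sum,
      ← Finset.mul_sum, hw1, ← hm]
    ring
  have h2 : ∀ i, w i * (d i - m) ^ 2 = w i * d i ^ 2 - 2 * m * (w i * d i) + m ^ 2 * w i :=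
    fun i => by ring
  simp_rw [h1, h2]
  rw [Finset.sum_add_distrib, Finset.sum_sub_distrib, ← Finset.mul_sum, ← Finset.mul_sum,
    Finset.sum_add_distrib, Finset.sum_sub_distrib, ← Finset.mul_sum, ← Finset.sum_mul, hw1, ← hm]
  ring

/-- A quantitative form of `sum_mul_le_log_sum_mul_exp`: the extra term is an eighth of the
variance of `d` under `w`, written as a sum over pairs. -/
theorem sum_mul_add_le_log_sum_mul_exp (hw : ∀ i, 0 ≤ w i) (hw1 : ∑ i, w i = 1)
    (hd : ∀ i j, |d i - d j| ≤ 1) :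
    ∑ i, w i * d i + 1 / 16 * ∑ i, ∑ j, w i * w j * (d i - d j) ^ 2 ≤
      Real.log (∑ i, w i * Real.exp (d i)) := by
  have hvar := sum_mul_sub_sq_eq (d := d) hw1
  set m := ∑ i, w i * d i with hm
  set V := ∑ i, w i * (d i - m) ^ 2 with hV
  have hdm : ∀ i, |d i - m| ≤ 1 := by
    intro i
    have : d i - m = ∑ j, w j * (d i - d j) := by
      simp_rw [mul_sub]
      rw [Finset.sum_sub_distrib, ← Finset.sum_mul, hw1, one_mul]
    rw [this]
    calc |∑ j, w j * (d i - d j)| ≤ ∑ j, |w j * (d i - d j)| := Finset.abs_sum_le_sum_abs _ _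
      _ ≤ ∑ j, w j := by
          refine Finset.sum_le_sum fun j _ => ?_
          rw [abs_mul, abs_of_nonneg (hw j)]
          exact mul_le_of_le_one_right (hw j) (hd i j)
      _ = 1 := hw1
  have hV0 : 0 ≤ V := Finset.sum_nonneg fun i _ => mul_nonneg (hw i) (sq_nonneg _)
  have hV1 : V ≤ 1 := by
    rw [← hw1]
    refine Finset.sum_le_sum fun i _ => mul_le_of_le_one_right (hw i) ?_
    exact (sq_le_one_iff_abs_le_one _).2 (hdm i)
  have h : Real.exp m * (1 + V / 4) ≤ ∑ i, w i * Real.exp (d i) := by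
    have h1 : ∀ i, w i * (Real.exp m * (1 + (d i - m) + (d i - m) ^ 2 / 4)) ≤
        w i * Real.exp (d i) := by
      intro i
      refine mul_le_mul_of_nonneg_left ?_ (hw i)
      calc _ ≤ Real.exp m * Real.exp (d i - m) := by
            gcongr
            exact one_add_add_sq_div_four_le_exp (hdm i)
        _ = Real.exp (d i) := by rw [← Real.exp_add]; ring_nf
    refine le_trans (le_of_eq ?_) (Finset.sum_le_sum fun i _ => h1 i)
    have h2 : ∀ i, w i * (Real.exp m * (1 + (d i - m) + (d i - m) ^ 2 / 4)) =
        Real.exp m * (w i * d i + (1 - m) * w i + 1 / 4 * (w i * (d i - m) ^ 2)) :=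
      fun i => by ring
    simp_rw [h2]
    rw [← Finset.mul_sum, Finset.sum_add_distrib, Finset.sum_add_distrib, ← Finset.mul_sum,
      ← Finset.mul_sum, hw1, ← hm, ← hV]
    ring
  have hlog : V / 8 ≤ Real.log (1 + V / 4) := by
    refine le_trans ?_ (Real.one_sub_inv_le_log_of_pos (by positivity))
    rw [le_sub_comm, inv_le_iff_one_le_mul₀ (by positivity)]
    nlinarith
  calc m + 1 / 16 * ∑ i, ∑ j, w i * w j * (d i - d j) ^ 2 = m + V / 8 := by linarith
    _ ≤ m + Real.log (1 + V / 4) := by gcongr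
    _ = Real.log (Real.exp m * (1 + V / 4)) := by
        rw [Real.log_mul (Real.exp_pos m).ne' (by positivity), Real.log_exp]
    _ ≤ _ := Real.log_le_log (by positivity) h

end Weighted

section Softmax

variable {n : ℕ}

theorem sum_available (S : OfferSet n) (f : Fin (n + 1) → ℝ) :
    ∑ i ∈ available S, f i = f 0 + ∑ i ∈ S, f i.succ := by
  have h0 : (0 : Fin (n + 1)) ∉ S.map (Fin.succEmb n) := by
    simp [Fin.succ_ne_zero]
  rw [available, Finset.sum_insert h0, Finset.sum_map]
  rfl

theorem zero_mem_available (S : OfferSet n) : 0 ∈ available S := Finset.mem_insert_self _ _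

theorem succ_mem_available {S : OfferSet n} {i : Fin n} : i.succ ∈ available S ↔ i ∈ S := by
  simp [available, Fin.succ_ne_zero]

theorem card_available (S : OfferSet n) : (available S).card = S.card + 1 := by
  rw [available, Finset.card_insert_of_notMem (by simp [Fin.succ_ne_zero]), Finset.card_map]

theorem sum_exp_available_pos (θ : Score n) (S : OfferSet n) :
    0 < ∑ i ∈ available S, Real.exp (θ i) :=
  Finset.sum_pos (fun _ _ => Real.exp_pos _) ⟨0, zero_mem_available S⟩

/-- The log-partition function over all available items; unlike the expression in `negLogLik` it
includes `exp (θ 0)`, so that `logSumExp θ S - θ j` is invariant under shifts of `θ`. -/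
noncomputable def logSumExp (θ : Score n) (S : OfferSet n) : ℝ :=
  Real.log (∑ i ∈ available S, Real.exp (θ i))

theorem logSumExp_sub (θ η : Score n) (S : OfferSet n) :
    logSumExp η S - logSumExp θ S =
      Real.log (∑ j, choiceProb θ S j * Real.exp (η j - θ j)) := by
  rw [logSumExp, logSumExp,
    ← Real.log_div (sum_exp_available_pos η S).ne' (sum_exp_available_pos θ S).ne']
  congr 1
  unfold choiceProb
  simp_rw [ite_mul, zero_mul]
  rw [Finset.sum_ite_mem, Finset.univ_inter, Finset.sum_div]
  refine Finset.sum_congr rfl fun j _ => ?_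
  rw [Real.exp_sub]
  field_simp

/-- The gradient of `logSumExp · S` at `θ` is `choiceProb θ S`, and the function lies above its
tangent. -/
theorem logSumExp_tangent (θ η : Score n) (S : OfferSet n) :
    ∑ j, choiceProb θ S j * (η j - θ j) ≤ logSumExp η S - logSumExp θ S := by
  rw [logSumExp_sub]
  exact sum_mul_le_log_sum_mul_exp (choiceProb_nonneg θ S) (sum_choiceProb θ S)

theorem logSumExp_strong_tangent (θ η : Score n) (S : OfferSet n)
    (h : ∀ i j, |(η i - θ i) - (η j - θ j)| ≤ 1) :
    ∑ j, choiceProb θ S j * (η j - θ j) + 1 / 16 * ∑ i, ∑ j,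
      choiceProb θ S i * choiceProb θ S j * ((η i - θ i) - (η j - θ j)) ^ 2 ≤
      logSumExp η S - logSumExp θ S := by
  rw [logSumExp_sub]
  exact sum_mul_add_le_log_sum_mul_exp (d := fun j => η j - θ j) (choiceProb_nonneg θ S)
    (sum_choiceProb θ S) h

theorem le_logSumExp (θ : Score n) {S : OfferSet n} {j : Fin (n + 1)} (hj : j ∈ available S) :
    θ j ≤ logSumExp θ S := by
  rw [logSumExp, Real.le_log_iff_exp_le (sum_exp_available_pos θ S)]
  exact Finset.single_le_sum (f := fun i => Real.exp (θ i)) (fun i _ => (Real.exp_pos _).le) hj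

theorem continuous_logSumExp (S : OfferSet n) : Continuous fun θ : Score n => logSumExp θ S := by
  unfold logSumExp
  exact Continuous.log (by fun_prop) fun θ => (sum_exp_available_pos θ S).ne'

end Softmax

/-! ### The likelihood in shift-invariant form -/

section Data

variable {n L : ℕ}

/-- Replaces choices outside `S ∪ {0}` by the no-purchase alternative. Such choices have
probability zero, but they occur in the sample space, and the estimator has to exist for them too.
-/
noncomputable def collapse (S : OfferSet n) (c : Fin (n + 1)) : Fin (n + 1) :=
  if c ∈ available S then c else 0

/-- The fraction of customers choosing `j` when `S` is offered, after `collapse`. For `L ≥ 1` it is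
a probability vector on `available S` for every realization, and agrees with `freq` on the products
of `S`. -/
noncomputable def obs (x : Sample n L) (S : OfferSet n) (j : Fin (n + 1)) : ℝ :=
  (1 / (L : ℝ)) * ∑ l : Fin L, {c | collapse S c = j}.indicator (fun _ => (1 : ℝ)) (x.2 S l)

theorem collapse_mem (S : OfferSet n) (c : Fin (n + 1)) : collapse S c ∈ available S := by
  unfold collapse
  split_ifs with h
  · exact h
  · exact zero_mem_available S

theorem collapse_eq_succ {S : OfferSet n} {i : Fin n} (hi : i ∈ S) (c : Fin (n + 1)) :
    collapse S c = i.succ ↔ c = i.succ := by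
  unfold collapse
  split_ifs with h
  · rfl
  · refine ⟨fun h0 => absurd h0.symm (Fin.succ_ne_zero i), fun hc => ?_⟩
    exact absurd (hc ▸ succ_mem_available.2 hi) h

theorem obs_nonneg (x : Sample n L) (S : OfferSet n) (j : Fin (n + 1)) : 0 ≤ obs x S j :=
  mul_nonneg (by positivity) (Finset.sum_nonneg fun l _ =>
    Set.indicator_nonneg (fun _ _ => zero_le_one) _)

theorem obs_eq_zero (x : Sample n L) {S : OfferSet n} {j : Fin (n + 1)} (hj : j ∉ available S) :
    obs x S j = 0 := by
  unfold obs
  rw [Finset.sum_eq_zero, mul_zero]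
  intro l _
  refine Set.indicator_of_notMem (fun h => hj ?_) _
  have h' : collapse S (x.2 S l) = j := h
  exact h' ▸ collapse_mem S _

theorem obs_succ (x : Sample n L) {S : OfferSet n} {i : Fin n} (hi : i ∈ S) :
    obs x S i.succ = freq x S i.succ := by
  unfold obs freq
  simp only [Set.indicator_apply, Set.mem_ofPred_eq, collapse_eq_succ hi]

theorem sum_obs (hL : 1 ≤ L) (x : Sample n L) (S : OfferSet n) : ∑ j, obs x S j = 1 := by
  have hL' : (L : ℝ) ≠ 0 := by positivity
  unfold obs
  rw [← Finset.mul_sum, Finset.sum_comm]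
  simp [Set.indicator_apply, hL']

theorem negLogLik_eq (x : Sample n L) {θ : Score n} (h0 : θ 0 = 0) :
    negLogLik x θ = ∑ S ∈ selected x, (logSumExp θ S - ∑ j, obs x S j * θ j) := by
  unfold negLogLik
  rw [← Finset.sum_neg_distrib]
  refine Finset.sum_congr rfl fun S _ => ?_
  have h1 : ∑ j, obs x S j * θ j = ∑ i ∈ S, freq x S i.succ * θ i.succ := by
    have : ∑ j, obs x S j * θ j = ∑ j ∈ available S, obs x S j * θ j := by
      refine (Finset.sum_subset (Finset.subset_univ _) fun j _ hj => ?_).symm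
      rw [obs_eq_zero x hj, zero_mul]
    rw [this, sum_available, h0, mul_zero, zero_add]
    exact Finset.sum_congr rfl fun i hi => by rw [obs_succ x hi]
  rw [h1, logSumExp, sum_available, h0, Real.exp_zero]
  ring

theorem negLogLik_nonneg (hL : 1 ≤ L) (x : Sample n L) {θ : Score n} (h0 : θ 0 = 0) :
    0 ≤ negLogLik x θ := by
  rw [negLogLik_eq x h0]
  refine Finset.sum_nonneg fun S _ => sub_nonneg.2 ?_
  calc ∑ j, obs x S j * θ j ≤ ∑ j, obs x S j * logSumExp θ S := by
        refine Finset.sum_le_sum fun j _ => ?_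
        by_cases hj : j ∈ available S
        · exact mul_le_mul_of_nonneg_left (le_logSumExp θ hj) (obs_nonneg x S j)
        · rw [obs_eq_zero x hj, zero_mul, zero_mul]
    _ = logSumExp θ S := by rw [← Finset.sum_mul, sum_obs hL, one_mul]

end Data

/-! ### Centred scores -/

section Spread

variable {n : ℕ}

/-- The squared Euclidean norm of the centred score vector. -/
noncomputable def spread (θ : Score n) : ℝ := ∑ i, (θ i - mean θ) ^ 2

theorem spread_nonneg (θ : Score n) : 0 ≤ spread θ := Finset.sum_nonneg fun _ _ => sq_nonneg _

theorem sum_eq_mul_mean (θ : Score n) : ∑ i, θ i = ((n : ℝ) + 1) * mean θ := by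
  unfold mean
  field_simp

theorem mean_add (θ η : Score n) : mean (θ + η) = mean θ + mean η := by
  simp [mean, Finset.sum_add_distrib, add_div]

theorem mean_smul (t : ℝ) (θ : Score n) : mean (t • θ) = t * mean θ := by
  simp [mean, ← Finset.mul_sum, mul_div_assoc]

theorem sum_sub_mean (θ : Score n) : ∑ i, (θ i - mean θ) = 0 := by
  rw [Finset.sum_sub_distrib, sum_eq_mul_mean]
  simp

theorem norm_sq_eq_spread_add (θ : Score n) :
    ‖θ‖ ^ 2 = spread θ + ((n : ℝ) + 1) * mean θ ^ 2 := by
  rw [EuclideanSpace.norm_sq_eq, spread]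
  have h : ∀ i, ‖θ i‖ ^ 2 = (θ i - mean θ) ^ 2 + (2 * mean θ * (θ i - mean θ) + mean θ ^ 2) := by
    intro i
    rw [Real.norm_eq_abs, sq_abs]
    ring
  simp_rw [h]
  rw [Finset.sum_add_distrib, Finset.sum_add_distrib, ← Finset.mul_sum, sum_sub_mean]
  simp

theorem sq_sub_mean_le_spread (θ : Score n) (i : Fin (n + 1)) : (θ i - mean θ) ^ 2 ≤ spread θ :=
  Finset.single_le_sum (f := fun i => (θ i - mean θ) ^ 2) (fun _ _ => sq_nonneg _)
    (Finset.mem_univ i)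

theorem mean_sq_le_spread {θ : Score n} (h0 : θ 0 = 0) : mean θ ^ 2 ≤ spread θ := by
  simpa [h0] using sq_sub_mean_le_spread θ 0

/-- On vectors with vanishing `0`-th coordinate the penalty controls the norm. -/
theorem norm_sq_le_mul_spread {θ : Score n} (h0 : θ 0 = 0) :
    ‖θ‖ ^ 2 ≤ ((n : ℝ) + 2) * spread θ := by
  rw [norm_sq_eq_spread_add]
  nlinarith [mean_sq_le_spread h0, (Nat.cast_nonneg n : (0 : ℝ) ≤ n)]

theorem sum_sum_sub_sq (θ : Score n) :
    ∑ i, ∑ j, (θ i - θ j) ^ 2 = 2 * ((n : ℝ) + 1) * spread θ := by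
  have h1 : ∀ i, ∑ j, (θ i - θ j) ^ 2 = ((n : ℝ) + 1) * (θ i - mean θ) ^ 2 + spread θ := by
    intro i
    have : ∀ j, (θ i - θ j) ^ 2 = (θ i - mean θ) ^ 2 -
        2 * (θ i - mean θ) * (θ j - mean θ) + (θ j - mean θ) ^ 2 := fun j => by ring
    simp_rw [this]
    rw [Finset.sum_add_distrib, Finset.sum_sub_distrib, ← Finset.mul_sum, sum_sub_mean, spread]
    simp
  simp_rw [h1]
  rw [Finset.sum_add_distrib, ← Finset.mul_sum]
  simp only [Finset.sum_const, Finset.card_univ, Fintype.card_fin, nsmul_eq_mul]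
  rw [← spread]
  push_cast
  ring

theorem spread_segment (θ η : Score n) (t : ℝ) :
    spread ((1 - t) • θ + t • η) =
      (1 - t) * spread θ + t * spread η - t * (1 - t) * spread (θ - η) := by
  have hs : θ - η = θ + (-1 : ℝ) • η := by module
  unfold spread
  rw [hs, mean_add, mean_add, mean_smul, mean_smul, mean_smul, Finset.mul_sum, Finset.mul_sum,
    Finset.mul_sum, ← Finset.sum_add_distrib, ← Finset.sum_sub_distrib]
  refine Finset.sum_congr rfl fun i _ => ?_
  simp only [PiLp.add_apply, PiLp.smul_apply, smul_eq_mul]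
  ring

theorem continuous_mean : Continuous fun θ : Score n => mean θ := by
  unfold mean
  fun_prop

theorem continuous_spread : Continuous fun θ : Score n => spread θ := by
  have := continuous_mean (n := n)
  unfold spread
  fun_prop

end Spread

/-! ### Existence and uniqueness of the estimator -/

section Estimator

variable {n L : ℕ}

theorem penalizedLoss_eq (lam : ℝ) (x : Sample n L) {θ : Score n} (h0 : θ 0 = 0) :
    penalizedLoss lam x θ =
      ∑ S ∈ selected x, (logSumExp θ S - ∑ j, obs x S j * θ j) + lam / 2 * spread θ := by
  rw [penalizedLoss, negLogLik_eq x h0, spread]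

/-- Strong convexity of the penalized loss with respect to `spread`. -/
theorem penalizedLoss_segment_le (lam : ℝ) (x : Sample n L) {θ η : Score n} (hθ : θ 0 = 0)
    (hη : η 0 = 0) {t : ℝ} (ht0 : 0 ≤ t) (ht1 : t ≤ 1) :
    penalizedLoss lam x ((1 - t) • θ + t • η) ≤
      (1 - t) * penalizedLoss lam x θ + t * penalizedLoss lam x η
        - lam / 2 * (t * (1 - t)) * spread (θ - η) := by
  set m := (1 - t) • θ + t • η with hm
  have hmi : ∀ i, m i = (1 - t) * θ i + t * η i := fun i => by simp [hm]
  have hm0 : m 0 = 0 := by rw [hmi, hθ, hη]; ring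
  rw [penalizedLoss_eq lam x hm0, penalizedLoss_eq lam x hθ, penalizedLoss_eq lam x hη,
    hm, spread_segment, ← hm]
  have key : ∑ S ∈ selected x, (logSumExp m S - ∑ j, obs x S j * m j) ≤
      (1 - t) * ∑ S ∈ selected x, (logSumExp θ S - ∑ j, obs x S j * θ j) +
      t * ∑ S ∈ selected x, (logSumExp η S - ∑ j, obs x S j * η j) := by
    rw [Finset.mul_sum, Finset.mul_sum, ← Finset.sum_add_distrib]
    refine Finset.sum_le_sum fun S _ => ?_
    have h1 := mul_le_mul_of_nonneg_left (logSumExp_tangent m θ S) (sub_nonneg.2 ht1)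
    have h2 := mul_le_mul_of_nonneg_left (logSumExp_tangent m η S) ht0
    have h3 : (1 - t) * ∑ j, choiceProb m S j * (θ j - m j) +
        t * ∑ j, choiceProb m S j * (η j - m j) = 0 := by
      rw [Finset.mul_sum, Finset.mul_sum, ← Finset.sum_add_distrib]
      refine Finset.sum_eq_zero fun j _ => ?_
      rw [hmi]
      ring
    have h4 : ∑ j, obs x S j * m j =
        (1 - t) * ∑ j, obs x S j * θ j + t * ∑ j, obs x S j * η j := by
      rw [Finset.mul_sum, Finset.mul_sum, ← Finset.sum_add_distrib]
      refine Finset.sum_congr rfl fun j _ => ?_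
      rw [hmi]
      ring
    rw [h4]
    linarith
  linarith

theorem existsUnique_isPenalizedMLE (hL : 1 ≤ L) {lam : ℝ} (hlam : 0 < lam) (x : Sample n L) :
    ∃! θ : Score n, IsPenalizedMLE lam x θ := by
  have hcont : ContinuousOn (penalizedLoss lam x) {θ : Score n | θ 0 = 0} := by
    have h : Continuous fun θ : Score n =>
        ∑ S ∈ selected x, (logSumExp θ S - ∑ j, obs x S j * θ j) + lam / 2 * spread θ := by
      have := continuous_spread (n := n)
      have := continuous_logSumExp (n := n)
      fun_prop
    exact h.continuousOn.congr fun θ hθ => penalizedLoss_eq lam x hθ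
  have hclosed : IsClosed {θ : Score n | θ 0 = 0} :=
    isClosed_eq (by fun_prop) continuous_const
  set K : Set (Score n) := {θ | θ 0 = 0} ∩
    penalizedLoss lam x ⁻¹' Set.Iic (penalizedLoss lam x 0) with hK
  have hKclosed : IsClosed K := hcont.preimage_isClosed_of_isClosed hclosed isClosed_Iic
  have hKbdd : Bornology.IsBounded K := by
    refine (Metric.isBounded_closedBall (x := (0 : Score n))
      (r := Real.sqrt (((n : ℝ) + 2) * (2 / lam * penalizedLoss lam x 0)))).subset ?_
    rintro θ ⟨hθ, hle⟩
    have hle' : penalizedLoss lam x θ ≤ penalizedLoss lam x 0 := hle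
    rw [mem_closedBall_zero_iff]
    refine Real.le_sqrt_of_sq_le ((norm_sq_le_mul_spread hθ).trans ?_)
    refine mul_le_mul_of_nonneg_left ?_ (by positivity)
    have h1 : lam / 2 * spread θ ≤ penalizedLoss lam x 0 := by
      refine le_trans ?_ hle'
      have := negLogLik_nonneg hL x hθ
      rw [penalizedLoss, ← spread]
      linarith
    calc spread θ = 2 / lam * (lam / 2 * spread θ) := by field_simp
      _ ≤ _ := by gcongr
  have hKne : K.Nonempty := ⟨0, by simp [hK]⟩
  obtain ⟨θ, hθK, hmin⟩ := (Metric.isCompact_of_isClosed_isBounded hKclosed hKbdd).exists_isMinOn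
    hKne (hcont.mono Set.inter_subset_left)
  have hθ : IsPenalizedMLE lam x θ := by
    refine ⟨hθK.1, fun η hη => ?_⟩
    by_cases h : penalizedLoss lam x η ≤ penalizedLoss lam x 0
    · exact hmin ⟨hη, h⟩
    · exact le_trans hθK.2 (not_le.1 h).le
  refine ⟨θ, hθ, fun η hη => ?_⟩
  have hseg := penalizedLoss_segment_le lam x hη.1 hθ.1 (t := 1 / 2) (by norm_num) (by norm_num)
  have h1 := hη.2 θ hθ.1
  have h2 := hθ.2 ((1 - (1 / 2 : ℝ)) • η + (1 / 2 : ℝ) • θ) (by simp [hη.1, hθ.1])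
  have h3 : spread (η - θ) ≤ 0 := by
    by_contra h
    have : 0 < lam / 2 * (1 / 2 * (1 - 1 / 2)) * spread (η - θ) := by
      have := not_le.1 h
      positivity
    linarith
  have h4 : (η - θ : Score n) 0 = 0 := by simp [hη.1, hθ.1]
  have h5 : ‖η - θ‖ ^ 2 ≤ 0 :=
    (norm_sq_le_mul_spread h4).trans (mul_nonpos_of_nonneg_of_nonpos (by positivity) h3)
  have h6 : ‖η - θ‖ = 0 := by nlinarith [norm_nonneg (η - θ)]
  exact sub_eq_zero.1 (norm_eq_zero.1 h6)

end Estimator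

/-! ### Concentration of the selected offer sets -/

section Selection

variable {n : ℕ}

/-- At least a quarter of all offer sets makes both `i` and `j` available. -/
theorem pow_le_four_mul_card_available (i j : Fin (n + 1)) :
    (2 : ℝ) ^ n ≤
      4 * ((Finset.univ.filter fun S : OfferSet n =>
        i ∈ available S ∧ j ∈ available S).card : ℝ) := by
  set T : OfferSet n := Finset.univ.filter fun k => k.succ = i ∨ k.succ = j with hT
  have hTcard : T.card ≤ 2 := by
    have h1 : T.map (Fin.succEmb n) ⊆ {i, j} := by
      intro k hk
      obtain ⟨a, ha, rfl⟩ := Finset.mem_map.1 hk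
      simpa [hT] using ha
    have h2 := Finset.card_le_card h1
    rw [Finset.card_map] at h2
    exact h2.trans Finset.card_le_two
  have hsub : Finset.Icc T Finset.univ ⊆
      Finset.univ.filter fun S : OfferSet n => i ∈ available S ∧ j ∈ available S := by
    intro S hS
    have hTS : T ⊆ S := (Finset.mem_Icc.1 hS).1
    have aux : ∀ k : Fin (n + 1), (k = i ∨ k = j) → k ∈ available S := by
      intro k hk
      refine Fin.cases (fun _ => zero_mem_available S) (fun a ha => ?_) k hk
      exact succ_mem_available.2 (hTS (by simpa [hT] using ha))
    exact Finset.mem_filter.2 ⟨Finset.mem_univ _, aux i (Or.inl rfl), aux j (Or.inr rfl)⟩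
  have h3 := Finset.card_le_card hsub
  rw [Finset.card_Icc_finset (Finset.subset_univ _), Finset.card_univ, Fintype.card_fin] at h3
  have h4 : 2 ^ n ≤ 4 * 2 ^ (n - T.card) := by
    calc 2 ^ n ≤ 2 ^ (2 + (n - T.card)) := Nat.pow_le_pow_right (by norm_num) (by omega)
      _ = 4 * 2 ^ (n - T.card) := by rw [pow_add]; norm_num
  have h5 : 2 ^ n ≤ 4 * (Finset.univ.filter fun S : OfferSet n =>
      i ∈ available S ∧ j ∈ available S).card := h4.trans (by gcongr)
  exact_mod_cast h5

/-- Offer sets with fewer than `n / 4` products are an exponentially small fraction. This is the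
exponential moment bound `∑ z ^ |S| = (1 + z) ^ n` at `z = (3 / 4) ^ 4`, for which `(1 + z) / (2 *
(3 / 4)) = 337 / 384 < 1`. -/
theorem card_small_le (n : ℕ) :
    ((Finset.univ.filter fun S : OfferSet n => 4 * S.card < n).card : ℝ) ≤
      2 ^ n * (337 / 384 : ℝ) ^ n := by
  have h1 : ∑ S : OfferSet n, (81 / 256 : ℝ) ^ S.card = (337 / 256 : ℝ) ^ n := by
    have h := Finset.sum_pow_mul_eq_add_pow (81 / 256 : ℝ) 1 (Finset.univ : Finset (Fin n))
    simp only [one_pow, mul_one, Finset.powerset_univ, Finset.card_univ, Fintype.card_fin] at h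
    rw [h]
    norm_num
  have h2 : ((Finset.univ.filter fun S : OfferSet n => 4 * S.card < n).card : ℝ) *
      (3 / 4 : ℝ) ^ n ≤ (337 / 256 : ℝ) ^ n := by
    rw [← h1, ← nsmul_eq_mul, ← Finset.sum_const]
    refine (Finset.sum_le_sum fun S hS => ?_).trans
      (Finset.sum_le_sum_of_subset_of_nonneg (Finset.subset_univ _) fun S _ _ => by positivity)
    have h3 : 4 * S.card ≤ n := (Finset.mem_filter.1 hS).2.le
    have h4 : (81 / 256 : ℝ) ^ S.card = (3 / 4 : ℝ) ^ (4 * S.card) := by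
      rw [pow_mul]; norm_num
    rw [h4]
    exact pow_le_pow_of_le_one (by norm_num) (by norm_num) h3
  have h5 : (2 : ℝ) ^ n * (337 / 384 : ℝ) ^ n = (337 / 256 : ℝ) ^ n / (3 / 4 : ℝ) ^ n := by
    rw [← mul_pow, ← div_pow]; norm_num
  rw [h5]
  exact (le_div_iff₀ (by positivity)).2 h2

/-- The first marginal of `dataLaw`: which offer sets are selected. -/
noncomputable def selectionLaw (n : ℕ) (p : unitInterval) : Measure (OfferSet n → Bool) :=
  Measure.pi fun _ : OfferSet n => ProbabilityTheory.bernoulliMeasure true false p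

instance (n : ℕ) (p : unitInterval) : IsProbabilityMeasure (selectionLaw n p) := by
  unfold selectionLaw
  infer_instance

/-- The offer sets selected by `σ`; `selected x` is `chosen x.1`. -/
def chosen (σ : OfferSet n → Bool) : Finset (OfferSet n) :=
  Finset.univ.filter fun S => σ S = true

theorem bernoulli_real_true (p : unitInterval) :
    (ProbabilityTheory.bernoulliMeasure true false p).real {true} = p := by
  rw [ProbabilityTheory.bernoulliMeasure_real_apply_of_mem_of_notMem] <;> simp

theorem card_chosen_filter (σ : OfferSet n → Bool) (F : Finset (OfferSet n)) :
    (((chosen σ) ∩ F).card : ℝ) =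
      ∑ S ∈ F, ({true} : Set Bool).indicator (fun _ => (1 : ℝ)) (σ S) := by
  have : chosen σ ∩ F = F.filter fun S => σ S = true := by
    ext S
    simp [chosen, and_comm]
  rw [this, Finset.card_filter]
  push_cast
  exact Finset.sum_congr rfl fun S _ => by simp [Set.indicator_apply]

theorem hasBernsteinMGF_card_chosen (p : unitInterval) (F : Finset (OfferSet n)) :
    HasBernsteinMGF (fun σ : OfferSet n → Bool => ((chosen σ ∩ F).card : ℝ) - F.card * (p : ℝ))
      (F.card * (p : ℝ)) (selectionLaw n p) := by
  have h := HasBernsteinMGF.sum_pi (ι := OfferSet n)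
    (μ := fun _ : OfferSet n => ProbabilityTheory.bernoulliMeasure true false p)
    F (fun S _ => HasBernsteinMGF.indicator_sub
      (ν := ProbabilityTheory.bernoulliMeasure true false p)
      (A := ({true} : Set Bool)) (measurableSet_singleton _))
  simp only [bernoulli_real_true, Finset.sum_sub_distrib, Finset.sum_const, nsmul_eq_mul,
    ← card_chosen_filter] at h
  exact h

theorem chosen_lower_tail (p : unitInterval) (F : Finset (OfferSet n)) :
    (selectionLaw n p).real {σ | ((chosen σ ∩ F).card : ℝ) ≤ F.card * (p : ℝ) / 2} ≤
      Real.exp (-(F.card * (p : ℝ) / 16)) := by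
  have h := (hasBernsteinMGF_card_chosen p F).neg.measureReal_ge_le (s := 1 / 4) (by norm_num)
    (by norm_num) (F.card * (p : ℝ) / 2)
  refine le_trans (measureReal_mono fun σ hσ => ?_) (h.trans (le_of_eq ?_))
  · have hσ' : ((chosen σ ∩ F).card : ℝ) ≤ F.card * (p : ℝ) / 2 := hσ
    change F.card * (p : ℝ) / 2 ≤ -(((chosen σ ∩ F).card : ℝ) - F.card * (p : ℝ))
    linarith
  · congr 1
    ring

theorem chosen_upper_tail (p : unitInterval) (F : Finset (OfferSet n)) :
    (selectionLaw n p).real {σ | 2 * (F.card * (p : ℝ)) ≤ ((chosen σ ∩ F).card : ℝ)} ≤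
      Real.exp (-(F.card * (p : ℝ) / 16)) := by
  have h := (hasBernsteinMGF_card_chosen p F).measureReal_ge_le (s := 1 / 4) (by norm_num)
    (by norm_num) (F.card * (p : ℝ))
  refine le_trans (measureReal_mono fun σ hσ => ?_) (h.trans (Real.exp_le_exp.2 ?_))
  · have hσ' : 2 * (F.card * (p : ℝ)) ≤ ((chosen σ ∩ F).card : ℝ) := hσ
    change F.card * (p : ℝ) ≤ ((chosen σ ∩ F).card : ℝ) - F.card * (p : ℝ)
    linarith
  · have : 0 ≤ F.card * (p : ℝ) := mul_nonneg (Nat.cast_nonneg _) p.2.1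
    linarith

theorem chosen_markov (p : unitInterval) (F : Finset (OfferSet n)) {t : ℝ} (ht : 0 < t) :
    (selectionLaw n p).real {σ | t ≤ ((chosen σ ∩ F).card : ℝ)} ≤ F.card * (p : ℝ) / t := by
  have hint : ∫ σ, ((chosen σ ∩ F).card : ℝ) ∂(selectionLaw n p) = F.card * (p : ℝ) := by
    simp_rw [card_chosen_filter]
    rw [integral_finsetSum _ fun S _ => Integrable.of_finite]
    have : ∀ S : OfferSet n, ∫ σ, ({true} : Set Bool).indicator (fun _ => (1 : ℝ)) (σ S)
        ∂(selectionLaw n p) = p := by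
      intro S
      rw [selectionLaw, integral_comp_eval
        (μ := fun _ : OfferSet n => ProbabilityTheory.bernoulliMeasure true false p)
        (f := ({true} : Set Bool).indicator (fun _ => (1 : ℝ)))
        (Integrable.of_finite.aestronglyMeasurable),
        integral_indicator_const _ (measurableSet_singleton _), bernoulli_real_true]
      simp
    rw [Finset.sum_congr rfl fun S _ => this S]
    simp
  have h := mul_meas_ge_le_integral_of_nonneg (μ := selectionLaw n p)
    (f := fun σ => ((chosen σ ∩ F).card : ℝ)) (ae_of_all _ fun σ => Nat.cast_nonneg _)
    Integrable.of_finite t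
  rw [hint] at h
  rw [le_div_iff₀ ht, mul_comm]
  exact h

/-- The properties of the selected offer sets used in the deterministic part; `N` stands for their
expected number. -/
structure IsGoodSelection (N : ℝ) (E : Finset (OfferSet n)) : Prop where
  pair : ∀ i j : Fin (n + 1),
    N / 8 ≤ ((E.filter fun S => i ∈ available S ∧ j ∈ available S).card : ℝ)
  card_le : (E.card : ℝ) ≤ 2 * N
  small : ((E.filter fun S => 4 * S.card < n).card : ℝ) ≤ N / (n : ℝ) ^ 2

theorem measureReal_not_isGoodSelection_le (hn : 1 ≤ n) (p : unitInterval) (hp : 0 < (p : ℝ)) :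
    (selectionLaw n p).real {σ | ¬ IsGoodSelection (2 ^ n * (p : ℝ)) (chosen σ)} ≤
      (((n : ℝ) + 1) ^ 2 + 1) * Real.exp (-(2 ^ n * (p : ℝ) / 64)) +
        (n : ℝ) ^ 2 * (337 / 384 : ℝ) ^ n := by
  set N : ℝ := 2 ^ n * (p : ℝ) with hN
  have hN0 : 0 < N := by positivity
  have hn0 : (0 : ℝ) < n := by exact_mod_cast hn
  let P : Fin (n + 1) × Fin (n + 1) → Finset (OfferSet n) := fun ij =>
    Finset.univ.filter fun S => ij.1 ∈ available S ∧ ij.2 ∈ available S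
  let Q : Finset (OfferSet n) := Finset.univ.filter fun S => 4 * S.card < n
  have hfilter : ∀ (E : Finset (OfferSet n)) (f : OfferSet n → Prop) [DecidablePred f],
      E.filter f = E ∩ Finset.univ.filter f := by
    intro E f _
    ext S
    simp
  have hsub : {σ | ¬ IsGoodSelection N (chosen σ)} ⊆
      (⋃ ij, {σ | ((chosen σ ∩ P ij).card : ℝ) ≤ (P ij).card * (p : ℝ) / 2}) ∪
      {σ | 2 * (((Finset.univ : Finset (OfferSet n)).card : ℝ) * (p : ℝ)) ≤
        ((chosen σ ∩ Finset.univ).card : ℝ)} ∪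
      {σ | N / (n : ℝ) ^ 2 ≤ ((chosen σ ∩ Q).card : ℝ)} := by
    intro σ hσ
    by_contra hcon
    simp only [Set.mem_union, Set.mem_iUnion, Set.mem_ofPred_eq, not_or, not_exists, not_le]
      at hcon
    obtain ⟨⟨h1, h2⟩, h3⟩ := hcon
    refine hσ ⟨fun i j => ?_, ?_, ?_⟩
    · rw [hfilter]
      refine le_trans ?_ (h1 (i, j)).le
      have h := mul_le_mul_of_nonneg_right (pow_le_four_mul_card_available i j) hp.le
      change N / 8 ≤ ((Finset.univ.filter fun S : OfferSet n =>
        i ∈ available S ∧ j ∈ available S).card : ℝ) * (p : ℝ) / 2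
      rw [← hN] at h
      linarith
    · simp only [Finset.inter_univ, Finset.card_univ, Fintype.card_finset, Fintype.card_fin] at h2
      push_cast at h2
      exact h2.le
    · rw [hfilter]
      exact h3.le
  refine (measureReal_mono hsub).trans ((measureReal_union_le _ _).trans ?_)
  refine add_le_add ((measureReal_union_le _ _).trans ?_) ?_
  · rw [add_mul, one_mul]
    refine add_le_add ((measureReal_iUnion_fintype_le _).trans ?_) ?_
    · have hbound : ∀ ij, (selectionLaw n p).real
          {σ | ((chosen σ ∩ P ij).card : ℝ) ≤ (P ij).card * (p : ℝ) / 2} ≤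
          Real.exp (-(N / 64)) := by
        intro ij
        refine (chosen_lower_tail p (P ij)).trans (Real.exp_le_exp.2 ?_)
        have h := mul_le_mul_of_nonneg_right (pow_le_four_mul_card_available ij.1 ij.2) hp.le
        rw [← hN] at h
        change _ ≤ 4 * ((P ij).card : ℝ) * (p : ℝ) at h
        linarith
      refine (Finset.sum_le_sum fun ij _ => hbound ij).trans (le_of_eq ?_)
      simp
      ring
    · refine (chosen_upper_tail p Finset.univ).trans (Real.exp_le_exp.2 ?_)
      simp only [Finset.card_univ, Fintype.card_finset, Fintype.card_fin]
      push_cast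
      rw [← hN]
      linarith
  · refine (chosen_markov p Q (by positivity)).trans ?_
    rw [div_le_iff₀ (by positivity)]
    have h := mul_le_mul_of_nonneg_right (card_small_le n) hp.le
    calc (Q.card : ℝ) * (p : ℝ) ≤ 2 ^ n * (337 / 384 : ℝ) ^ n * (p : ℝ) := h
      _ = (n : ℝ) ^ 2 * (337 / 384 : ℝ) ^ n * (N / (n : ℝ) ^ 2) := by
          rw [hN]
          field_simp

end Selection

/-! ### Concentration of the likelihood gradient -/

section Noise

variable {n L : ℕ}

/-- The negative gradient of `negLogLik` at the score `θ`, including the coordinate of the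
no-purchase alternative. -/
noncomputable def noise (x : Sample n L) (θ : Score n) (j : Fin (n + 1)) : ℝ :=
  ∑ S ∈ selected x, (obs x S j - choiceProb θ S j)

theorem choiceLaw_real_collapse (θ : Score n) (S : OfferSet n) (j : Fin (n + 1)) :
    (choiceLaw θ S).toMeasure.real {c | collapse S c = j} = choiceProb θ S j := by
  rw [measureReal_def, PMF.toMeasure_apply_fintype]
  have h : ∀ c, ({c | collapse S c = j} : Set (Fin (n + 1))).indicator (choiceLaw θ S) c =
      if c = j then ENNReal.ofReal (choiceProb θ S j) else 0 := by
    intro c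
    have hval : choiceLaw θ S c = ENNReal.ofReal (choiceProb θ S c) := rfl
    by_cases hc : c ∈ available S
    · by_cases hcj : c = j
      · subst hcj
        simp [collapse, hc, hval]
      · simp [collapse, hc, hcj]
    · have h0 : choiceProb θ S c = 0 := by simp [choiceProb, hc]
      by_cases hcj : c = j
      · subst hcj
        simp [Set.indicator_apply, hval, h0]
      · simp [Set.indicator_apply, hval, h0, hcj]
  simp_rw [h]
  simp [ENNReal.toReal_ofReal (choiceProb_nonneg θ S j)]

/-- The second marginal of `dataLaw`: the choices at all offer sets. -/
noncomputable def choicesLaw (n L : ℕ) (θ : Score n) :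
    Measure (OfferSet n → Fin L → Fin (n + 1)) :=
  Measure.pi fun S : OfferSet n => Measure.pi fun _ : Fin L => (choiceLaw θ S).toMeasure

instance (n L : ℕ) (θ : Score n) : IsProbabilityMeasure (choicesLaw n L θ) := by
  unfold choicesLaw
  infer_instance

theorem hasBernsteinMGF_mul_noise (hL : 1 ≤ L) (θ : Score n) (σ : OfferSet n → Bool)
    (j : Fin (n + 1)) :
    HasBernsteinMGF (fun y : OfferSet n → Fin L → Fin (n + 1) => (L : ℝ) * noise (σ, y) θ j)
      (L * ∑ S ∈ chosen σ, choiceProb θ S j) (choicesLaw n L θ) := by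
  have hL' : (L : ℝ) ≠ 0 := by positivity
  have h1 := fun S : OfferSet n => HasBernsteinMGF.indicator_sub (ν := (choiceLaw θ S).toMeasure)
    (A := {c | collapse S c = j}) (Set.toFinite _).measurableSet
  have h2 := HasBernsteinMGF.sum_pi (ι := OfferSet n)
    (μ := fun S : OfferSet n => Measure.pi fun _ : Fin L => (choiceLaw θ S).toMeasure)
    (chosen σ) (fun S _ => HasBernsteinMGF.sum_pi (ι := Fin L)
      (μ := fun _ : Fin L => (choiceLaw θ S).toMeasure) Finset.univ (fun _ _ => h1 S))
  simp only [choiceLaw_real_collapse] at h2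
  have e1 : (fun y : OfferSet n → Fin L → Fin (n + 1) => ∑ S ∈ chosen σ, ∑ l : Fin L,
      (({c | collapse S c = j} : Set (Fin (n + 1))).indicator (fun _ => (1 : ℝ)) (y S l) -
        choiceProb θ S j)) = fun y => (L : ℝ) * noise (σ, y) θ j := by
    funext y
    rw [noise, Finset.mul_sum]
    refine Finset.sum_congr rfl fun S _ => ?_
    rw [Finset.sum_sub_distrib, obs]
    simp only [Finset.sum_const, Finset.card_univ, Fintype.card_fin, nsmul_eq_mul]
    field_simp
  have e2 : ∑ S ∈ chosen σ, ∑ _l : Fin L, choiceProb θ S j =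
      L * ∑ S ∈ chosen σ, choiceProb θ S j := by
    rw [Finset.mul_sum]
    exact Finset.sum_congr rfl fun S _ => by simp
  rw [e1, e2] at h2
  exact h2

/-- The Bernstein bound for the noise given the selection, in the Gaussian range `ℓ ≤ v`. -/
theorem noise_tail (hL : 1 ≤ L) (θ : Score n) (σ : OfferSet n → Bool) (j : Fin (n + 1))
    {v ℓ : ℝ} (hℓ : 0 ≤ ℓ) (hv : 0 < v) (hℓv : ℓ ≤ v)
    (hσ : L * ∑ S ∈ chosen σ, choiceProb θ S j ≤ v) :
    (choicesLaw n L θ).real {y | 2 * Real.sqrt (ℓ * v) ≤ L * |noise (σ, y) θ j|} ≤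
      2 * Real.exp (-ℓ) := by
  have hs1 : Real.sqrt (ℓ / v) ≤ 1 := Real.sqrt_le_one.2 ((div_le_one hv).2 hℓv)
  have h := ((hasBernsteinMGF_mul_noise hL θ σ j).mono hσ).measureReal_abs_ge_le
    (Real.sqrt_nonneg (ℓ / v)) hs1 (2 * Real.sqrt (ℓ * v))
  have e1 : ∀ y : OfferSet n → Fin L → Fin (n + 1), |(L : ℝ) * noise (σ, y) θ j| =
      L * |noise (σ, y) θ j| := fun y => by
    rw [abs_mul, abs_of_nonneg (Nat.cast_nonneg L)]
  simp_rw [e1] at h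
  refine h.trans (le_of_eq ?_)
  have e2 : Real.sqrt (ℓ / v) * Real.sqrt (ℓ * v) = ℓ := by
    rw [← Real.sqrt_mul (by positivity)]
    have : ℓ / v * (ℓ * v) = ℓ ^ 2 := by field_simp
    rw [this, Real.sqrt_sq hℓ]
  rw [Real.sq_sqrt (by positivity), div_mul_cancel₀ _ hv.ne']
  congr 2
  linarith

theorem choiceProb_le_one (θ : Score n) (S : OfferSet n) (j : Fin (n + 1)) :
    choiceProb θ S j ≤ 1 := by
  rw [← sum_choiceProb θ S]
  exact Finset.single_le_sum (fun i _ => choiceProb_nonneg θ S i) (Finset.mem_univ j)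

/-- All preference scores `exp (θ i)` lie in `[k⁻¹, k]`. With `θ 0 = 0` this follows from a
condition number of at most `k`. -/
def IsScoreBound (k : ℝ) (θ : Score n) : Prop :=
  ∀ i, k⁻¹ ≤ Real.exp (θ i) ∧ Real.exp (θ i) ≤ k

theorem isScoreBound_of_condNumber_le {θ : Score n} {k : ℝ} (h0 : θ 0 = 0)
    (h : condNumber θ ≤ k) : IsScoreBound k θ := by
  have hb1 : BddAbove (Set.range fun i => Real.exp (θ i)) := (Set.finite_range _).bddAbove
  have hb2 : BddBelow (Set.range fun i => Real.exp (θ i)) := (Set.finite_range _).bddBelow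
  set M := ⨆ i, Real.exp (θ i) with hM
  set m := ⨅ i, Real.exp (θ i) with hm
  have hle : ∀ i, Real.exp (θ i) ≤ M := fun i => le_ciSup hb1 i
  have hge : ∀ i, m ≤ Real.exp (θ i) := fun i => ciInf_le hb2 i
  have hmpos : 0 < m := by
    obtain ⟨i, hi⟩ := exists_eq_ciInf_of_finite (f := fun i => Real.exp (θ i))
    rw [hm, ← hi]
    exact Real.exp_pos _
  have hM1 : 1 ≤ M := by simpa [h0] using hle 0
  have hm1 : m ≤ 1 := by simpa [h0] using hge 0
  have hMk : M ≤ k * m := (div_le_iff₀ hmpos).1 h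
  have hk : 0 < k := by
    by_contra hk
    nlinarith
  intro i
  refine ⟨?_, (hle i).trans (by nlinarith)⟩
  rw [inv_le_iff_one_le_mul₀ hk]
  nlinarith [hge i]

theorem IsScoreBound.mono {θ : Score n} {k k' : ℝ} (h : IsScoreBound k θ) (hk : 0 < k)
    (hkk : k ≤ k') : IsScoreBound k' θ := fun i =>
  ⟨(inv_anti₀ hk hkk).trans (h i).1, (h i).2.trans hkk⟩

theorem IsScoreBound.sum_ge {θ : Score n} {k : ℝ} (h : IsScoreBound k θ) (S : OfferSet n) :
    ((S.card : ℝ) + 1) * k⁻¹ ≤ ∑ i ∈ available S, Real.exp (θ i) := by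
  have := Finset.card_nsmul_le_sum (available S) (fun i => Real.exp (θ i)) k⁻¹ fun i _ => (h i).1
  rw [card_available, nsmul_eq_mul] at this
  exact_mod_cast this

theorem IsScoreBound.sum_le {θ : Score n} {k : ℝ} (h : IsScoreBound k θ) (S : OfferSet n) :
    ∑ i ∈ available S, Real.exp (θ i) ≤ ((S.card : ℝ) + 1) * k := by
  have := Finset.sum_le_card_nsmul (available S) (fun i => Real.exp (θ i)) k fun i _ => (h i).2
  rw [card_available, nsmul_eq_mul] at this
  exact_mod_cast this

theorem IsScoreBound.choiceProb_le {θ : Score n} {k : ℝ} (hk : 0 < k) (h : IsScoreBound k θ)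
    (S : OfferSet n) (j : Fin (n + 1)) : choiceProb θ S j ≤ k ^ 2 / ((S.card : ℝ) + 1) := by
  unfold choiceProb
  split_ifs
  · calc Real.exp (θ j) / ∑ i ∈ available S, Real.exp (θ i) ≤ k / (((S.card : ℝ) + 1) * k⁻¹) :=
          div_le_div₀ hk.le (h j).2 (by positivity) (h.sum_ge S)
      _ = k ^ 2 / ((S.card : ℝ) + 1) := by field_simp
  · positivity

theorem IsScoreBound.le_choiceProb {θ : Score n} {k : ℝ} (hk : 0 < k) (h : IsScoreBound k θ)
    {S : OfferSet n} {j : Fin (n + 1)} (hj : j ∈ available S) :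
    (k ^ 2 * ((n : ℝ) + 1))⁻¹ ≤ choiceProb θ S j := by
  rw [choiceProb, if_pos hj]
  have hS : (S.card : ℝ) ≤ n := by
    have := Finset.card_le_univ S
    rw [Fintype.card_fin] at this
    exact_mod_cast this
  calc (k ^ 2 * ((n : ℝ) + 1))⁻¹ = k⁻¹ / (((n : ℝ) + 1) * k) := by field_simp
    _ ≤ _ := div_le_div₀ (Real.exp_pos _).le (h j).1 (sum_exp_available_pos θ S)
        ((h.sum_le S).trans (by gcongr))

/-- A sum over the selected sets of a quantity that is at most `1`, and at most `B` when `S` has at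
least `n / 4` products. -/
theorem IsGoodSelection.sum_le {N B : ℝ} {E : Finset (OfferSet n)} (hE : IsGoodSelection N E)
    {f : OfferSet n → ℝ} (hB : 0 ≤ B) (hf : ∀ S, f S ≤ 1)
    (hfl : ∀ S : OfferSet n, n ≤ 4 * S.card → f S ≤ B) :
    ∑ S ∈ E, f S ≤ 2 * N * B + N / (n : ℝ) ^ 2 := by
  rw [← Finset.sum_filter_add_sum_filter_not E (fun S => 4 * S.card < n), add_comm]
  refine add_le_add ?_ ?_
  · calc _ ≤ ∑ S ∈ E.filter (fun S => ¬ 4 * S.card < n), B :=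
          Finset.sum_le_sum fun S hS => hfl S (not_lt.1 (Finset.mem_filter.1 hS).2)
      _ = ((E.filter (fun S => ¬ 4 * S.card < n)).card : ℝ) * B := by simp
      _ ≤ 2 * N * B := by
          refine mul_le_mul_of_nonneg_right (le_trans ?_ hE.card_le) hB
          exact_mod_cast Finset.card_le_card (Finset.filter_subset _ _)
  · calc _ ≤ ∑ S ∈ E.filter (fun S => 4 * S.card < n), (1 : ℝ) :=
          Finset.sum_le_sum fun S _ => hf S
      _ = ((E.filter (fun S => 4 * S.card < n)).card : ℝ) := by simp
      _ ≤ _ := hE.small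

theorem IsGoodSelection.sum_choiceProb_le {N k : ℝ} (hn : 1 ≤ n) (hk : 1 ≤ k) (hN : 0 ≤ N)
    {E : Finset (OfferSet n)} (hE : IsGoodSelection N E) {θ : Score n} (hθ : IsScoreBound k θ)
    (j : Fin (n + 1)) : ∑ S ∈ E, choiceProb θ S j ≤ 9 * k ^ 2 * N / n := by
  have hn0 : (1 : ℝ) ≤ n := by exact_mod_cast hn
  refine (hE.sum_le (B := 4 * k ^ 2 / n) (by positivity) (fun S => choiceProb_le_one θ S j)
    fun S hS => ?_).trans ?_
  · refine (hθ.choiceProb_le (by linarith) S j).trans ?_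
    rw [div_le_div_iff₀ (by positivity) (by positivity)]
    have hS' : (n : ℝ) ≤ 4 * S.card := by exact_mod_cast hS
    nlinarith [sq_nonneg k]
  · have h1 : N / (n : ℝ) ^ 2 ≤ k ^ 2 * N / n :=
      div_le_div₀ (by positivity) (le_mul_of_one_le_left hN (one_le_pow₀ hk)) (by positivity)
        (le_self_pow₀ hn0 (by norm_num))
    calc 2 * N * (4 * k ^ 2 / n) + N / (n : ℝ) ^ 2 ≤
          2 * N * (4 * k ^ 2 / n) + k ^ 2 * N / n := by gcongr
      _ = _ := by ring

theorem prod_real_le_of_section_le {α β : Type*} [MeasurableSpace α] [MeasurableSpace β]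
    (μ : Measure α) (ν : Measure β) [IsProbabilityMeasure μ] [IsProbabilityMeasure ν]
    {s : Set (α × β)} (hs : MeasurableSet s) {c : ℝ} (hc : 0 ≤ c)
    (h : ∀ a, ν.real (Prod.mk a ⁻¹' s) ≤ c) : (μ.prod ν).real s ≤ c := by
  refine ENNReal.toReal_le_of_le_ofReal hc ?_
  rw [Measure.prod_apply hs]
  calc ∫⁻ a, ν (Prod.mk a ⁻¹' s) ∂μ ≤ ∫⁻ _, ENNReal.ofReal c ∂μ :=
        lintegral_mono fun a => by
          rw [← ofReal_measureReal]
          exact ENNReal.ofReal_le_ofReal (h a)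
    _ = ENNReal.ofReal c := by simp

/-- The event on which the error bound is deterministic. -/
structure IsGoodSample (N γ : ℝ) (θ : Score n) (x : Sample n L) : Prop where
  selection : IsGoodSelection N (selected x)
  noise_le : ∀ j, |noise x θ j| ≤ γ

theorem measureReal_not_isGoodSample_le (hn : 1 ≤ n) (hL : 1 ≤ L) (p : unitInterval)
    (hp : 0 < (p : ℝ)) {k ℓ : ℝ} (hk : 1 ≤ k) {θ : Score n} (hθ : IsScoreBound k θ)
    (hℓ : 0 ≤ ℓ) (hℓN : n * ℓ ≤ 2 ^ n * (p : ℝ)) :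
    (dataLaw n L p θ).real {x | ¬ IsGoodSample (2 ^ n * (p : ℝ))
        (6 * k * Real.sqrt (2 ^ n * (p : ℝ) * ℓ / (n * L))) θ x} ≤
      (((n : ℝ) + 1) ^ 2 + 1) * Real.exp (-(2 ^ n * (p : ℝ) / 64)) +
        (n : ℝ) ^ 2 * (337 / 384 : ℝ) ^ n + ((n : ℝ) + 1) * (2 * Real.exp (-ℓ)) := by
  set N : ℝ := 2 ^ n * (p : ℝ) with hN
  have hN0 : 0 < N := by positivity
  have hn0 : (1 : ℝ) ≤ n := by exact_mod_cast hn
  have hL0 : (1 : ℝ) ≤ L := by exact_mod_cast hL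
  set τ := Real.sqrt (N * ℓ / (n * L)) with hτ
  have hlaw : dataLaw n L p θ = (selectionLaw n p).prod (choicesLaw n L θ) := rfl
  have hsub : {x : Sample n L | ¬ IsGoodSample N (6 * k * τ) θ x} ⊆
      ({σ | ¬ IsGoodSelection N (chosen σ)} ×ˢ Set.univ) ∪
      ⋃ j, {x | IsGoodSelection N (chosen x.1) ∧ 6 * k * τ ≤ |noise x θ j|} := by
    intro x hx
    by_cases hE : IsGoodSelection N (chosen x.1)
    · right
      have : ¬ ∀ j, |noise x θ j| ≤ 6 * k * τ := fun h => hx ⟨hE, h⟩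
      obtain ⟨j, hj⟩ := not_forall.1 this
      exact Set.mem_iUnion.2 ⟨j, hE, (not_le.1 hj).le⟩
    · left
      exact ⟨hE, trivial⟩
  refine (measureReal_mono hsub).trans ((measureReal_union_le _ _).trans (add_le_add ?_ ?_))
  · rw [hlaw, measureReal_prod_prod]
    simpa using measureReal_not_isGoodSelection_le hn p hp
  · refine (measureReal_iUnion_fintype_le _).trans ?_
    have hj : ∀ j, (dataLaw n L p θ).real
        {x | IsGoodSelection N (chosen x.1) ∧ 6 * k * τ ≤ |noise x θ j|} ≤ 2 * Real.exp (-ℓ) := by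
      intro j
      rw [hlaw]
      refine prod_real_le_of_section_le _ _ (Set.toFinite _).measurableSet (by positivity) ?_
      intro σ
      by_cases hE : IsGoodSelection N (chosen σ)
      · have hv : (0 : ℝ) < L * (9 * k ^ 2 * N / n) := by positivity
        have hℓv : ℓ ≤ L * (9 * k ^ 2 * N / n) := by
          have h1 : ℓ ≤ N / n := by
            rw [le_div_iff₀ (by positivity)]
            linarith
          have h2 : (1 : ℝ) ≤ L * (9 * k ^ 2) := by
            have : (1 : ℝ) ≤ k ^ 2 := one_le_pow₀ hk
            nlinarith
          calc ℓ ≤ N / n := h1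
            _ = 1 * (N / n) := by ring
            _ ≤ (L * (9 * k ^ 2)) * (N / n) := by gcongr
            _ = _ := by ring
        refine le_trans (measureReal_mono fun y hy => ?_) (noise_tail hL θ σ j hℓ hv hℓv
          (mul_le_mul_of_nonneg_left (hE.sum_choiceProb_le hn hk hN0.le hθ j) (by positivity)))
        have hy' : 6 * k * τ ≤ |noise (σ, y) θ j| := hy.2
        have e : 2 * Real.sqrt (ℓ * (L * (9 * k ^ 2 * N / n))) = L * (6 * k * τ) := by
          have h3 : ℓ * (L * (9 * k ^ 2 * N / n)) = (3 * k * L) ^ 2 * (N * ℓ / (n * L)) := by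
            field_simp
            ring
          rw [h3, Real.sqrt_mul (by positivity), Real.sqrt_sq (by positivity), ← hτ]
          ring
        change 2 * Real.sqrt (ℓ * (L * (9 * k ^ 2 * N / n))) ≤ L * |noise (σ, y) θ j|
        rw [e]
        gcongr
      · have : Prod.mk σ ⁻¹' {x : Sample n L | IsGoodSelection N (chosen x.1) ∧
            6 * k * τ ≤ |noise x θ j|} = ∅ := by
          ext y
          simp [hE]
        rw [this, measureReal_empty]
        positivity
    refine (Finset.sum_le_sum fun j _ => hj j).trans (le_of_eq ?_)
    simp

end Noise

/-! ### The centred part of the error -/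

section Localization

variable {n L : ℕ}

theorem sum_noise (hL : 1 ≤ L) (x : Sample n L) (θ : Score n) : ∑ j, noise x θ j = 0 := by
  unfold noise
  rw [Finset.sum_comm]
  refine Finset.sum_eq_zero fun S _ => ?_
  rw [Finset.sum_sub_distrib, sum_obs hL, sum_choiceProb, sub_self]

theorem sum_abs_sub_mean_le (d : Score n) :
    ∑ i, |d i - mean d| ≤ Real.sqrt ((n : ℝ) + 1) * Real.sqrt (spread d) := by
  rw [← Real.sqrt_mul (by positivity)]
  refine Real.le_sqrt_of_sq_le ?_
  have h := sq_sum_le_card_mul_sum_sq (s := Finset.univ) (f := fun i => |d i - mean d|)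
  simp only [sq_abs, Finset.card_univ, Fintype.card_fin] at h
  rw [← spread] at h
  exact_mod_cast h

/-- As the noise sums to zero, it only sees the centred part of `d`. -/
theorem abs_sum_noise_mul_le (hL : 1 ≤ L) {x : Sample n L} {θ : Score n} {γ : ℝ}
    (hγ : ∀ j, |noise x θ j| ≤ γ) (d : Score n) :
    |∑ j, noise x θ j * d j| ≤ γ * (Real.sqrt ((n : ℝ) + 1) * Real.sqrt (spread d)) := by
  have h1 : ∑ j, noise x θ j * d j = ∑ j, noise x θ j * (d j - mean d) := by
    simp_rw [mul_sub]
    rw [Finset.sum_sub_distrib, ← Finset.sum_mul, sum_noise hL]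
    ring
  rw [h1]
  calc |∑ j, noise x θ j * (d j - mean d)| ≤ ∑ j, |noise x θ j * (d j - mean d)| :=
        Finset.abs_sum_le_sum_abs _ _
    _ ≤ ∑ j, γ * |d j - mean d| := by
        refine Finset.sum_le_sum fun j _ => ?_
        rw [abs_mul]
        exact mul_le_mul_of_nonneg_right (hγ j) (abs_nonneg _)
    _ = γ * ∑ j, |d j - mean d| := by rw [Finset.mul_sum]
    _ ≤ _ := mul_le_mul_of_nonneg_left (sum_abs_sub_mean_le d)
        ((abs_nonneg _).trans (hγ 0))

theorem spread_add_ge (θ d : Score n) :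
    spread θ - 2 * (Real.sqrt (spread θ) * Real.sqrt (spread d)) ≤ spread (θ + d) := by
  have h1 : spread (θ + d) = spread θ + spread d +
      2 * ∑ i, (θ i - mean θ) * (d i - mean d) := by
    unfold spread
    rw [mean_add, Finset.mul_sum, ← Finset.sum_add_distrib, ← Finset.sum_add_distrib]
    refine Finset.sum_congr rfl fun i _ => ?_
    simp only [PiLp.add_apply]
    ring
  have h2 : |∑ i, (θ i - mean θ) * (d i - mean d)| ≤
      Real.sqrt (spread θ) * Real.sqrt (spread d) := by
    rw [← Real.sqrt_mul (spread_nonneg θ), ← Real.sqrt_sq_eq_abs]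
    exact Real.sqrt_le_sqrt (Finset.sum_mul_sq_le_sq_mul_sq _ _ _)
  have h3 := (abs_le.1 h2).1
  have h4 := spread_nonneg d
  rw [h1]
  linarith

theorem IsScoreBound.abs_apply_le {θ : Score n} {k : ℝ} (hk : 1 ≤ k) (h : IsScoreBound k θ)
    (i : Fin (n + 1)) : |θ i| ≤ k := by
  have hk0 : 0 < k := by linarith
  have h1 : θ i ≤ k := by
    have := (h i).2
    linarith [Real.add_one_le_exp (θ i)]
  have h2 : -θ i ≤ k := by
    have h3 : Real.exp (-θ i) ≤ k := by
      rw [Real.exp_neg]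
      exact inv_le_of_inv_le₀ hk0 (h i).1
    linarith [Real.add_one_le_exp (-θ i)]
  exact abs_le.2 ⟨by linarith, h1⟩

theorem IsScoreBound.sqrt_spread_le {θ : Score n} {k : ℝ} (hk : 1 ≤ k) (h : IsScoreBound k θ) :
    Real.sqrt (spread θ) ≤ Real.sqrt ((n : ℝ) + 1) * k := by
  have h1 : spread θ ≤ ((n : ℝ) + 1) * k ^ 2 := by
    have h2 : spread θ ≤ ‖θ‖ ^ 2 := by
      rw [norm_sq_eq_spread_add]
      have : 0 ≤ ((n : ℝ) + 1) * mean θ ^ 2 := by positivity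
      linarith
    refine h2.trans ?_
    rw [EuclideanSpace.norm_sq_eq]
    calc ∑ i, ‖θ i‖ ^ 2 ≤ ∑ _i : Fin (n + 1), k ^ 2 := by
          refine Finset.sum_le_sum fun i _ => ?_
          exact pow_le_pow_left₀ (norm_nonneg _) (h.abs_apply_le hk i) 2
      _ = ((n : ℝ) + 1) * k ^ 2 := by simp
  calc Real.sqrt (spread θ) ≤ Real.sqrt (((n : ℝ) + 1) * k ^ 2) := Real.sqrt_le_sqrt h1
    _ = _ := by rw [Real.sqrt_mul (by positivity), Real.sqrt_sq (by linarith)]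

/-- The Hessian of the likelihood dominates a multiple of `N / n` on centred vectors. It is a sum
over pairs of items, and every pair occurs in `N / 8` selected sets with weight of order `n⁻²`. -/
theorem IsGoodSelection.curvature {N k : ℝ} (hk : 0 < k) {E : Finset (OfferSet n)}
    (hE : IsGoodSelection N E) {θ : Score n} (hθ : IsScoreBound k θ) (d : Score n) :
    N / (64 * k ^ 4 * ((n : ℝ) + 1)) * spread d ≤ ∑ S ∈ E, 1 / 16 * ∑ i, ∑ j,
      choiceProb θ S i * choiceProb θ S j * (d i - d j) ^ 2 := by
  set q : ℝ := (k ^ 2 * ((n : ℝ) + 1))⁻¹ with hq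
  have hq0 : 0 < q := by positivity
  have hpair : ∀ i j : Fin (n + 1), N / 8 * (q ^ 2 * (d i - d j) ^ 2) ≤
      ∑ S ∈ E, choiceProb θ S i * choiceProb θ S j * (d i - d j) ^ 2 := by
    intro i j
    calc N / 8 * (q ^ 2 * (d i - d j) ^ 2) ≤
          ((E.filter fun S => i ∈ available S ∧ j ∈ available S).card : ℝ) *
            (q ^ 2 * (d i - d j) ^ 2) :=
          mul_le_mul_of_nonneg_right (hE.pair i j) (by positivity)
      _ = ∑ S ∈ E.filter (fun S => i ∈ available S ∧ j ∈ available S),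
            q ^ 2 * (d i - d j) ^ 2 := by rw [Finset.sum_const, nsmul_eq_mul]
      _ ≤ ∑ S ∈ E.filter (fun S => i ∈ available S ∧ j ∈ available S),
            choiceProb θ S i * choiceProb θ S j * (d i - d j) ^ 2 := by
          refine Finset.sum_le_sum fun S hS => ?_
          obtain ⟨_, hi, hj⟩ := Finset.mem_filter.1 hS
          rw [sq q]
          exact mul_le_mul_of_nonneg_right (mul_le_mul (hθ.le_choiceProb hk hi)
            (hθ.le_choiceProb hk hj) hq0.le (choiceProb_nonneg _ _ _)) (sq_nonneg _)
      _ ≤ _ := Finset.sum_le_sum_of_subset_of_nonneg (Finset.filter_subset _ _) fun S _ _ =>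
          mul_nonneg (mul_nonneg (choiceProb_nonneg _ _ _) (choiceProb_nonneg _ _ _))
            (sq_nonneg _)
  have h1 : ∑ S ∈ E, 1 / 16 * ∑ i, ∑ j, choiceProb θ S i * choiceProb θ S j * (d i - d j) ^ 2 =
      1 / 16 * ∑ i, ∑ j, ∑ S ∈ E, choiceProb θ S i * choiceProb θ S j * (d i - d j) ^ 2 := by
    rw [← Finset.mul_sum, Finset.sum_comm]
    congr 1
    exact Finset.sum_congr rfl fun i _ => Finset.sum_comm
  rw [h1]
  calc N / (64 * k ^ 4 * ((n : ℝ) + 1)) * spread d =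
        1 / 16 * (N / 8 * (q ^ 2 * (2 * ((n : ℝ) + 1) * spread d))) := by
          rw [hq]
          field_simp
          ring
    _ = 1 / 16 * ∑ i, ∑ j, N / 8 * (q ^ 2 * (d i - d j) ^ 2) := by
          rw [← sum_sum_sub_sq]
          simp_rw [Finset.mul_sum]
    _ ≤ _ := by
          refine mul_le_mul_of_nonneg_left ?_ (by norm_num)
          exact Finset.sum_le_sum fun i _ => Finset.sum_le_sum fun j _ => hpair i j

/-- Growth of the penalized loss around the true score: curvature against the gradient of the
likelihood and of the penalty. -/
theorem IsGoodSample.penalizedLoss_add_ge (hL : 1 ≤ L) {N γ k lam : ℝ} (hk : 1 ≤ k)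
    (hlam : 0 ≤ lam) {θ : Score n} (hθ0 : θ 0 = 0) (hθ : IsScoreBound k θ) {x : Sample n L}
    (hx : IsGoodSample N γ θ x) {d : Score n} (hd0 : d 0 = 0)
    (hd : Real.sqrt (spread d) ≤ 1 / 2) :
    penalizedLoss lam x θ + N / (64 * k ^ 4 * ((n : ℝ) + 1)) * spread d -
      Real.sqrt ((n : ℝ) + 1) * (γ + lam * k) * Real.sqrt (spread d) ≤
      penalizedLoss lam x (θ + d) := by
  have hη0 : (θ + d) 0 = 0 := by simp [hθ0, hd0]
  rw [penalizedLoss_eq lam x hθ0, penalizedLoss_eq lam x hη0]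
  have hdi : ∀ i, |d i - mean d| ≤ 1 / 2 := fun i => by
    rw [← Real.sqrt_sq_eq_abs]
    exact (Real.sqrt_le_sqrt (sq_sub_mean_le_spread d i)).trans hd
  have hdij : ∀ i j, |d i - d j| ≤ 1 := by
    intro i j
    have h1 := abs_le.1 (hdi i)
    have h2 := abs_le.1 (hdi j)
    exact abs_le.2 ⟨by linarith, by linarith⟩
  have hsub : ∀ i, (θ + d) i - θ i = d i := fun i => by simp
  have hlse : ∑ S ∈ selected x, (∑ j, choiceProb θ S j * d j + 1 / 16 * ∑ i, ∑ j,
      choiceProb θ S i * choiceProb θ S j * (d i - d j) ^ 2) ≤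
      ∑ S ∈ selected x, (logSumExp (θ + d) S - logSumExp θ S) := by
    refine Finset.sum_le_sum fun S _ => ?_
    have h := logSumExp_strong_tangent θ (θ + d) S (by simpa only [hsub] using hdij)
    simpa only [hsub] using h
  rw [Finset.sum_add_distrib] at hlse
  have hcurv := hx.selection.curvature (by linarith) hθ d
  have hnoise : ∑ S ∈ selected x, ∑ j, obs x S j * d j -
      ∑ S ∈ selected x, ∑ j, choiceProb θ S j * d j = ∑ j, noise x θ j * d j := by
    rw [← Finset.sum_sub_distrib]
    simp_rw [noise, Finset.sum_mul]
    rw [Finset.sum_comm]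
    refine Finset.sum_congr rfl fun S _ => ?_
    rw [← Finset.sum_sub_distrib]
    exact Finset.sum_congr rfl fun j _ => by ring
  have hnoise' := (abs_le.1 (abs_sum_noise_mul_le hL hx.noise_le d)).2
  have hpen := mul_le_mul_of_nonneg_left (spread_add_ge θ d) (show (0 : ℝ) ≤ lam / 2 by linarith)
  have hsp := mul_le_mul_of_nonneg_left (mul_le_mul_of_nonneg_right (hθ.sqrt_spread_le hk)
    (Real.sqrt_nonneg (spread d))) hlam
  have hobs : ∑ S ∈ selected x, (logSumExp (θ + d) S - ∑ j, obs x S j * (θ + d) j) -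
      ∑ S ∈ selected x, (logSumExp θ S - ∑ j, obs x S j * θ j) =
      ∑ S ∈ selected x, (logSumExp (θ + d) S - logSumExp θ S) -
        ∑ S ∈ selected x, ∑ j, obs x S j * d j := by
    rw [← Finset.sum_sub_distrib, ← Finset.sum_sub_distrib]
    refine Finset.sum_congr rfl fun S _ => ?_
    have : ∑ j, obs x S j * (θ + d) j = ∑ j, obs x S j * θ j + ∑ j, obs x S j * d j := by
      rw [← Finset.sum_add_distrib]
      exact Finset.sum_congr rfl fun j _ => by simp [mul_add]
    rw [this]
    ring
  nlinarith

/-- A minimizer outside the ball of radius `ρ` would make the loss on the boundary, along the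
segment to `θ`, no larger than at `θ`. -/
theorem IsGoodSample.sqrt_spread_sub_le (hL : 1 ≤ L) {N γ k lam ρ : ℝ} (hk : 1 ≤ k)
    (hlam : 0 ≤ lam) {θ : Score n} (hθ0 : θ 0 = 0) (hθ : IsScoreBound k θ) {x : Sample n L}
    (hx : IsGoodSample N γ θ x) (hρ0 : 0 < ρ) (hρ1 : ρ ≤ 1 / 2)
    (hρ : Real.sqrt ((n : ℝ) + 1) * (γ + lam * k) < N / (64 * k ^ 4 * ((n : ℝ) + 1)) * ρ)
    {η : Score n} (hη : IsPenalizedMLE lam x η) : Real.sqrt (spread (η - θ)) ≤ ρ := by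
  by_contra hcon
  rw [not_le] at hcon
  set r := Real.sqrt (spread (η - θ)) with hr
  have hr0 : 0 < r := hρ0.trans hcon
  set t := ρ / r with ht
  have ht0 : 0 < t := by positivity
  have ht1 : t ≤ 1 := (div_le_one hr0).2 hcon.le
  have hd0 : (t • (η - θ)) 0 = 0 := by simp [hη.1, hθ0]
  have hspread : Real.sqrt (spread (t • (η - θ))) = ρ := by
    have h1 : spread (t • (η - θ)) = t ^ 2 * spread (η - θ) := by
      unfold spread
      rw [mean_smul, Finset.mul_sum]
      refine Finset.sum_congr rfl fun i _ => ?_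
      simp only [PiLp.smul_apply, smul_eq_mul]
      ring
    rw [h1, Real.sqrt_mul (by positivity), Real.sqrt_sq ht0.le, ← hr, ht, div_mul_cancel₀ _ hr0.ne']
  have h1 := hx.penalizedLoss_add_ge hL hk hlam hθ0 hθ hd0 (by rw [hspread]; exact hρ1)
  have h2 := penalizedLoss_segment_le lam x hθ0 hη.1 ht0.le ht1
  have h3 : (1 - t) • θ + t • η = θ + t • (η - θ) := by module
  rw [h3] at h2
  have h4 := hη.2 θ hθ0
  have h5 : 0 ≤ lam / 2 * (t * (1 - t)) * spread (θ - η) :=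
    mul_nonneg (mul_nonneg (by linarith) (mul_nonneg ht0.le (by linarith))) (spread_nonneg _)
  have h6 : spread (t • (η - θ)) = ρ ^ 2 := by
    rw [← hspread, Real.sq_sqrt (spread_nonneg _)]
  rw [hspread, h6] at h1
  have h7 := mul_lt_mul_of_pos_right hρ hρ0
  nlinarith

end Localization

/-! ### The mean of the error -/

section NoPurchase

variable {n L : ℕ}

theorem choiceProb_zero (θ : Score n) (S : OfferSet n) :
    choiceProb θ S 0 = Real.exp (θ 0) / ∑ i ∈ available S, Real.exp (θ i) := by
  rw [choiceProb, if_pos (zero_mem_available S)]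

/-- Stationarity along the direction `(0, 1, …, 1)`, which raises all products together. -/
theorem IsPenalizedMLE.sum_obs_zero_sub_eq (hL : 1 ≤ L) {lam : ℝ} {x : Sample n L} {θ : Score n}
    (h : IsPenalizedMLE lam x θ) :
    ∑ S ∈ selected x, (obs x S 0 - choiceProb θ S 0) = -(lam * mean θ) := by
  obtain ⟨h0, hmin⟩ := h
  let e : Score n := WithLp.toLp 2 fun i => if i = 0 then 0 else 1
  have he0 : e 0 = 0 := by simp [e]
  have hes : ∀ i : Fin n, e i.succ = 1 := fun i => by simp [e, Fin.succ_ne_zero]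
  have hline0 : ∀ t : ℝ, (θ + t • e) 0 = 0 := fun t => by simp [h0, he0]
  have hline : ∀ (t : ℝ) (i : Fin n), (θ + t • e) i.succ = θ i.succ + t := fun t i => by
    simp [hes]
  have hlocmin : IsLocalMin (fun t : ℝ => penalizedLoss lam x (θ + t • e)) 0 := by
    refine Filter.Eventually.of_forall fun t => ?_
    simpa using hmin (θ + t • e) (hline0 t)
  have hlse : ∀ S : OfferSet n, HasDerivAt (fun t : ℝ => logSumExp (θ + t • e) S)
      (1 - choiceProb θ S 0) 0 := by
    intro S
    have hf : ∀ t : ℝ, logSumExp (θ + t • e) S =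
        Real.log (1 + (∑ i ∈ S, Real.exp (θ i.succ)) * Real.exp t) := by
      intro t
      rw [logSumExp, sum_available, hline0, Real.exp_zero, Finset.sum_mul]
      simp_rw [hline, Real.exp_add]
    have hA : 0 ≤ ∑ i ∈ S, Real.exp (θ i.succ) :=
      Finset.sum_nonneg fun i _ => (Real.exp_pos _).le
    have hd := (((Real.hasDerivAt_exp 0).const_mul
      (∑ i ∈ S, Real.exp (θ i.succ))).const_add 1).log
      (by have := mul_nonneg hA (Real.exp_pos 0).le; positivity)
    rw [funext hf]
    refine hd.congr_deriv ?_
    rw [choiceProb_zero, sum_available, h0, Real.exp_zero, mul_one]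
    field_simp
    ring
  have hobs : ∀ S : OfferSet n, HasDerivAt (fun t : ℝ => ∑ j, obs x S j * (θ + t • e) j)
      (1 - obs x S 0) 0 := by
    intro S
    have h1 : ∑ i : Fin n, obs x S i.succ = 1 - obs x S 0 := by
      have := sum_obs hL x S
      rw [Fin.sum_univ_succ] at this
      linarith
    have hf : ∀ t : ℝ, ∑ j, obs x S j * (θ + t • e) j =
        ∑ i : Fin n, obs x S i.succ * θ i.succ + (1 - obs x S 0) * t := by
      intro t
      rw [Fin.sum_univ_succ, hline0, mul_zero, zero_add, ← h1, Finset.sum_mul,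
        ← Finset.sum_add_distrib]
      exact Finset.sum_congr rfl fun i _ => by rw [hline]; ring
    rw [funext hf]
    simpa using ((hasDerivAt_id (0 : ℝ)).const_mul (1 - obs x S 0)).const_add
      (∑ i : Fin n, obs x S i.succ * θ i.succ)
  have hspread : HasDerivAt (fun t : ℝ => spread (θ + t • e)) (2 * mean θ) 0 := by
    have hcross : ∑ i, (θ i - mean θ) * (e i - mean e) = mean θ := by
      simp_rw [mul_sub]
      rw [Finset.sum_sub_distrib, ← Finset.sum_mul, sum_sub_mean, zero_mul, sub_zero,
        Fin.sum_univ_succ, he0, mul_zero, zero_add]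
      simp_rw [hes, mul_one]
      have := sum_sub_mean θ
      rw [Fin.sum_univ_succ, h0] at this
      linarith
    have hf : ∀ t : ℝ, spread (θ + t • e) = spread θ + (2 * mean θ) * t + spread e * t ^ 2 := by
      intro t
      rw [← hcross]
      unfold spread
      rw [mean_add, mean_smul, Finset.mul_sum, Finset.sum_mul, Finset.sum_mul,
        ← Finset.sum_add_distrib, ← Finset.sum_add_distrib]
      refine Finset.sum_congr rfl fun i _ => ?_
      simp only [PiLp.add_apply, PiLp.smul_apply, smul_eq_mul]
      ring
    rw [funext hf]
    have h1 := (((hasDerivAt_id (0 : ℝ)).const_mul (2 * mean θ)).const_add (spread θ)).add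
      ((hasDerivAt_pow 2 (0 : ℝ)).const_mul (spread e))
    refine (h1.congr_deriv (by simp)).congr_of_eventuallyEq
      (Filter.Eventually.of_forall fun t => ?_)
    simp
  have hderiv : HasDerivAt (fun t : ℝ => penalizedLoss lam x (θ + t • e))
      (∑ S ∈ selected x, ((1 - choiceProb θ S 0) - (1 - obs x S 0)) +
        lam / 2 * (2 * mean θ)) 0 := by
    rw [funext fun t => penalizedLoss_eq lam x (hline0 t)]
    exact (HasDerivAt.fun_sum fun S _ => (hlse S).sub (hobs S)).add (hspread.const_mul _)
  have hzero := hlocmin.hasDerivAt_eq_zero hderiv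
  have h2 : ∑ S ∈ selected x, (obs x S 0 - choiceProb θ S 0) =
      ∑ S ∈ selected x, ((1 - choiceProb θ S 0) - (1 - obs x S 0)) :=
    Finset.sum_congr rfl fun S _ => by ring
  rw [h2]
  linarith

theorem abs_exp_add_sub_le {m u : ℝ} (hm : |m| ≤ 1 / 2) (hu : |u| ≤ 1 / 2) :
    |Real.exp (m + u) - Real.exp m| ≤ 4 * |u| := by
  have h1 : Real.exp m ≤ 2 := by
    have h := (abs_le.1 (Real.abs_exp_sub_one_le (x := m) (by linarith))).2
    linarith
  have h2 : |Real.exp u - 1| ≤ 2 * |u| := Real.abs_exp_sub_one_le (by linarith)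
  have h3 : Real.exp (m + u) - Real.exp m = Real.exp m * (Real.exp u - 1) := by
    rw [Real.exp_add]; ring
  rw [h3, abs_mul, abs_of_pos (Real.exp_pos m)]
  calc Real.exp m * |Real.exp u - 1| ≤ 2 * (2 * |u|) := by gcongr
    _ = _ := by ring

theorem abs_le_two_mul_abs_exp_sub_one {m : ℝ} (hm : |m| ≤ 1 / 2) :
    |m| ≤ 2 * |Real.exp m - 1| := by
  have h1 := Real.abs_exp_sub_one_sub_id_le (x := m) (by linarith)
  have h2 : |m| ≤ |Real.exp m - 1| + |Real.exp m - 1 - m| := by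
    have h3 : m = (Real.exp m - 1) - (Real.exp m - 1 - m) := by ring
    calc |m| = |(Real.exp m - 1) - (Real.exp m - 1 - m)| := by rw [← h3]
      _ ≤ _ := abs_sub _ _
  have h4 : m ^ 2 ≤ |m| / 2 := by
    rw [← sq_abs]
    nlinarith [abs_nonneg m]
  linarith

/-- First-order expansion of the no-purchase probability: a shift of all products by the mean of
`d` gives the main term, and the centred part of `d` only enters with weight `1 / (|S| + 1)²`. -/
theorem abs_choiceProb_zero_sub_sub_le {θ d : Score n} {k : ℝ} (hk : 0 < k) (hθ0 : θ 0 = 0)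
    (hθ : IsScoreBound k θ) (hd0 : d 0 = 0) (hθd : IsScoreBound (3 * k) (θ + d))
    (hd : ∀ i, |d i - mean d| ≤ 1 / 2) (S : OfferSet n) :
    |choiceProb θ S 0 - choiceProb (θ + d) S 0 - (Real.exp (mean d) - 1) *
      ((∑ i ∈ S, Real.exp (θ i.succ)) / ((∑ i ∈ available S, Real.exp (θ i)) *
        ∑ i ∈ available S, Real.exp ((θ + d) i)))| ≤
      12 * k ^ 3 / ((S.card : ℝ) + 1) ^ 2 * ∑ i, |d i - mean d| := by
  set m := mean d with hm
  set D := ∑ i ∈ available S, Real.exp (θ i) with hD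
  set D' := ∑ i ∈ available S, Real.exp ((θ + d) i) with hD'
  have hDpos : 0 < D := sum_exp_available_pos θ S
  have hDpos' : 0 < D' := sum_exp_available_pos (θ + d) S
  have hm2 : |m| ≤ 1 / 2 := by simpa [hd0] using hd 0
  have hdiff : D' - D = ∑ i ∈ S, Real.exp (θ i.succ) * (Real.exp (d i.succ) - 1) := by
    rw [hD, hD', sum_available, sum_available]
    simp only [PiLp.add_apply, hθ0, hd0, add_zero]
    rw [add_sub_add_left_eq_sub, ← Finset.sum_sub_distrib]
    exact Finset.sum_congr rfl fun i _ => by rw [Real.exp_add]; ring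
  have h1 : choiceProb θ S 0 - choiceProb (θ + d) S 0 - (Real.exp m - 1) *
      ((∑ i ∈ S, Real.exp (θ i.succ)) / (D * D')) =
      (∑ i ∈ S, Real.exp (θ i.succ) * (Real.exp (d i.succ) - Real.exp m)) / (D * D') := by
    have h2 : ∑ i ∈ S, Real.exp (θ i.succ) * (Real.exp (d i.succ) - Real.exp m) =
        (D' - D) - (Real.exp m - 1) * ∑ i ∈ S, Real.exp (θ i.succ) := by
      rw [hdiff, Finset.mul_sum, ← Finset.sum_sub_distrib]
      exact Finset.sum_congr rfl fun i _ => by ring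
    rw [h2, choiceProb_zero, choiceProb_zero, ← hD, ← hD']
    simp only [PiLp.add_apply, hθ0, hd0, add_zero, Real.exp_zero]
    field_simp
  rw [h1, abs_div, abs_of_pos (mul_pos hDpos hDpos')]
  have h3 : |∑ i ∈ S, Real.exp (θ i.succ) * (Real.exp (d i.succ) - Real.exp m)| ≤
      4 * k * ∑ i, |d i - m| := by
    calc _ ≤ ∑ i ∈ S, |Real.exp (θ i.succ) * (Real.exp (d i.succ) - Real.exp m)| :=
          Finset.abs_sum_le_sum_abs _ _
      _ ≤ ∑ i ∈ S, 4 * k * |d i.succ - m| := by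
          refine Finset.sum_le_sum fun i _ => ?_
          have h4 := abs_exp_add_sub_le hm2 (hd i.succ)
          rw [add_sub_cancel] at h4
          rw [abs_mul, abs_of_pos (Real.exp_pos _)]
          calc _ ≤ k * (4 * |d i.succ - m|) :=
                mul_le_mul (hθ i.succ).2 h4 (abs_nonneg _) hk.le
            _ = _ := by ring
      _ ≤ ∑ i : Fin n, 4 * k * |d i.succ - m| :=
          Finset.sum_le_sum_of_subset_of_nonneg (Finset.subset_univ _) fun i _ _ => by positivity
      _ = 4 * k * ∑ i : Fin n, |d i.succ - m| := by rw [Finset.mul_sum]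
      _ ≤ _ := by
          rw [Fin.sum_univ_succ]
          have := abs_nonneg (d 0 - m)
          gcongr
          linarith
  have h5 : ((S.card : ℝ) + 1) * k⁻¹ * (((S.card : ℝ) + 1) * (3 * k)⁻¹) ≤ D * D' :=
    mul_le_mul (hθ.sum_ge S) (hθd.sum_ge S) (by positivity) hDpos.le
  calc _ ≤ (4 * k * ∑ i, |d i - m|) /
        (((S.card : ℝ) + 1) * k⁻¹ * (((S.card : ℝ) + 1) * (3 * k)⁻¹)) :=
        div_le_div₀ (by positivity) h3 (by positivity) h5
    _ = _ := by
        field_simp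
        ring

/-- The coefficients of the main term in `abs_choiceProb_zero_sub_sub_le` add up to order `N / n`:
it suffices to count the selected sets that contain one fixed product. -/
theorem IsGoodSelection.sum_ratio_ge (hn : 1 ≤ n) {N k : ℝ} (hk : 0 < k)
    {E : Finset (OfferSet n)} (hE : IsGoodSelection N E) {θ η : Score n}
    (hθ : IsScoreBound k θ) (hη : IsScoreBound (3 * k) η) :
    N / (48 * k ^ 3 * ((n : ℝ) + 1)) ≤
      ∑ S ∈ E, (∑ i ∈ S, Real.exp (θ i.succ)) / ((∑ i ∈ available S, Real.exp (θ i)) *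
        ∑ i ∈ available S, Real.exp (η i)) := by
  let i₀ : Fin n := ⟨0, hn⟩
  have hcard := hE.pair 0 i₀.succ
  have hterm : ∀ S : OfferSet n, i₀.succ ∈ available S → 1 / (6 * k ^ 3 * ((n : ℝ) + 1)) ≤
      (∑ i ∈ S, Real.exp (θ i.succ)) / ((∑ i ∈ available S, Real.exp (θ i)) *
        ∑ i ∈ available S, Real.exp (η i)) := by
    intro S hS
    have hS1 : 1 ≤ S.card := Finset.card_pos.2 ⟨i₀, succ_mem_available.1 hS⟩
    have hS1' : (1 : ℝ) ≤ S.card := by exact_mod_cast hS1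
    have hSn : (S.card : ℝ) ≤ n := by
      have := Finset.card_le_univ S
      rw [Fintype.card_fin] at this
      exact_mod_cast this
    have h1 : (S.card : ℝ) * k⁻¹ ≤ ∑ i ∈ S, Real.exp (θ i.succ) := by
      have := Finset.card_nsmul_le_sum S (fun i => Real.exp (θ i.succ)) k⁻¹
        fun i _ => (hθ i.succ).1
      rwa [nsmul_eq_mul] at this
    have h2 : (∑ i ∈ available S, Real.exp (θ i)) * ∑ i ∈ available S, Real.exp (η i) ≤
        ((S.card : ℝ) + 1) * k * (((S.card : ℝ) + 1) * (3 * k)) :=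
      mul_le_mul (hθ.sum_le S) (hη.sum_le S) (sum_exp_available_pos η S).le (by positivity)
    refine le_trans ?_ (div_le_div₀ (Finset.sum_nonneg fun i _ => (Real.exp_pos _).le) h1
      (mul_pos (sum_exp_available_pos θ S) (sum_exp_available_pos η S)) h2)
    have h3 : (S.card : ℝ) * k⁻¹ / (((S.card : ℝ) + 1) * k * (((S.card : ℝ) + 1) * (3 * k))) =
        S.card / (3 * k ^ 3 * ((S.card : ℝ) + 1) ^ 2) := by
      field_simp
    rw [h3, div_le_div_iff₀ (by positivity) (by positivity)]
    have h4 : ((S.card : ℝ) + 1) ^ 2 ≤ S.card * (2 * ((n : ℝ) + 1)) := by nlinarith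
    calc 1 * (3 * k ^ 3 * ((S.card : ℝ) + 1) ^ 2) = 3 * k ^ 3 * ((S.card : ℝ) + 1) ^ 2 := one_mul _
      _ ≤ 3 * k ^ 3 * (S.card * (2 * ((n : ℝ) + 1))) := by gcongr
      _ = _ := by ring
  calc N / (48 * k ^ 3 * ((n : ℝ) + 1)) = N / 8 * (1 / (6 * k ^ 3 * ((n : ℝ) + 1))) := by
        field_simp
        ring
    _ ≤ ((E.filter fun S => 0 ∈ available S ∧ i₀.succ ∈ available S).card : ℝ) *
          (1 / (6 * k ^ 3 * ((n : ℝ) + 1))) :=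
        mul_le_mul_of_nonneg_right hcard (by positivity)
    _ = ∑ S ∈ E.filter (fun S => 0 ∈ available S ∧ i₀.succ ∈ available S),
          1 / (6 * k ^ 3 * ((n : ℝ) + 1)) := by rw [Finset.sum_const, nsmul_eq_mul]
    _ ≤ ∑ S ∈ E.filter (fun S => 0 ∈ available S ∧ i₀.succ ∈ available S), _ :=
        Finset.sum_le_sum fun S hS => hterm S (Finset.mem_filter.1 hS).2.2
    _ ≤ _ := Finset.sum_le_sum_of_subset_of_nonneg (Finset.filter_subset _ _) fun S _ _ =>
        div_nonneg (Finset.sum_nonneg fun i _ => (Real.exp_pos _).le)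
          (mul_pos (sum_exp_available_pos θ S) (sum_exp_available_pos η S)).le

theorem IsGoodSelection.sum_inv_sq_le (hn : 1 ≤ n) {N : ℝ}
    {E : Finset (OfferSet n)} (hE : IsGoodSelection N E) :
    ∑ S ∈ E, 1 / ((S.card : ℝ) + 1) ^ 2 ≤ 33 * N / (n : ℝ) ^ 2 := by
  have hn0 : (0 : ℝ) < n := by exact_mod_cast hn
  refine (hE.sum_le (B := 16 / (n : ℝ) ^ 2) (by positivity) (fun S => ?_) fun S hS => ?_).trans
    (le_of_eq (by ring))
  · rw [div_le_one (by positivity)]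
    exact one_le_pow₀ (by linarith [(Nat.cast_nonneg S.card : (0 : ℝ) ≤ S.card)])
  · have hS' : (n : ℝ) ≤ 4 * S.card := by exact_mod_cast hS
    rw [div_le_div_iff₀ (by positivity) (by positivity)]
    nlinarith

theorem IsScoreBound.add {θ d : Score n} {k : ℝ} (hk : 0 < k) (hθ : IsScoreBound k θ)
    (hd : ∀ i, |d i| ≤ 1) : IsScoreBound (3 * k) (θ + d) := by
  have he : Real.exp 1 ≤ 3 := Real.exp_one_lt_three.le
  intro i
  obtain ⟨h1, h2⟩ := abs_le.1 (hd i)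
  simp only [PiLp.add_apply, Real.exp_add]
  have h3 : Real.exp (d i) ≤ 3 := (Real.exp_le_exp.2 h2).trans he
  have h4 : (3 : ℝ)⁻¹ ≤ Real.exp (d i) := by
    refine le_trans ?_ (Real.exp_le_exp.2 h1)
    rw [Real.exp_neg]
    exact inv_anti₀ (Real.exp_pos 1) he
  constructor
  · rw [mul_inv, mul_comm]
    exact mul_le_mul (hθ i).1 h4 (by positivity) (Real.exp_pos _).le
  · rw [mul_comm 3 k]
    exact mul_le_mul (hθ i).2 h3 (Real.exp_pos _).le hk.le

/-- The mean of the error, from comparing the no-purchase probabilities at the estimator and at the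
true score. -/
theorem IsGoodSample.abs_mean_sub_le (hn : 1 ≤ n) (hL : 1 ≤ L) {N γ k lam : ℝ} (hk : 1 ≤ k)
    (hN : 0 < N) (hlam : 0 ≤ lam) {θ : Score n} (hθ0 : θ 0 = 0) (hθ : IsScoreBound k θ)
    {x : Sample n L} (hx : IsGoodSample N γ θ x) {η : Score n} (hη : IsPenalizedMLE lam x η)
    (hr : Real.sqrt (spread (η - θ)) ≤ 1 / 2) :
    |mean (η - θ)| ≤ 96 * k ^ 3 * ((n : ℝ) + 1) / N * (γ + 2 * lam * k + 396 * k ^ 3 * N /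
      (n : ℝ) ^ 2 * (Real.sqrt ((n : ℝ) + 1) * Real.sqrt (spread (η - θ)))) := by
  have hk0 : 0 < k := by linarith
  set d := η - θ with hd
  have hηd : η = θ + d := by rw [hd]; abel
  have hd0 : d 0 = 0 := by simp [hd, hη.1, hθ0]
  have hdi : ∀ i, |d i - mean d| ≤ 1 / 2 := fun i => by
    rw [← Real.sqrt_sq_eq_abs]
    exact (Real.sqrt_le_sqrt (sq_sub_mean_le_spread d i)).trans hr
  have hm : |mean d| ≤ 1 / 2 := by simpa [hd0] using hdi 0
  have hd1 : ∀ i, |d i| ≤ 1 := fun i => by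
    have h1 := abs_le.1 (hdi i)
    have h2 := abs_le.1 hm
    exact abs_le.2 ⟨by linarith, by linarith⟩
  have hη3 : IsScoreBound (3 * k) (θ + d) := hθ.add hk0 hd1
  have hfoc := hη.sum_obs_zero_sub_eq hL
  rw [hηd] at hfoc
  set T : OfferSet n → ℝ := fun S => (∑ i ∈ S, Real.exp (θ i.succ)) /
    ((∑ i ∈ available S, Real.exp (θ i)) * ∑ i ∈ available S, Real.exp ((θ + d) i)) with hT
  set U := ∑ i, |d i - mean d| with hU
  have hU0 : 0 ≤ U := Finset.sum_nonneg fun i _ => abs_nonneg _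
  have hUle := sum_abs_sub_mean_le d
  rw [← hU] at hUle
  have hsum : ∑ S ∈ selected x, (choiceProb θ S 0 - choiceProb (θ + d) S 0) =
      -(lam * mean (θ + d)) - noise x θ 0 := by
    rw [← hfoc, noise, ← Finset.sum_sub_distrib]
    exact Finset.sum_congr rfl fun S _ => by ring
  have hrem : |∑ S ∈ selected x, (choiceProb θ S 0 - choiceProb (θ + d) S 0) -
      (Real.exp (mean d) - 1) * ∑ S ∈ selected x, T S| ≤ 396 * k ^ 3 * N / (n : ℝ) ^ 2 * U := by
    rw [Finset.mul_sum, ← Finset.sum_sub_distrib]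
    calc _ ≤ ∑ S ∈ selected x, |choiceProb θ S 0 - choiceProb (θ + d) S 0 -
          (Real.exp (mean d) - 1) * T S| := Finset.abs_sum_le_sum_abs _ _
      _ ≤ ∑ S ∈ selected x, 12 * k ^ 3 / ((S.card : ℝ) + 1) ^ 2 * U :=
          Finset.sum_le_sum fun S _ =>
            abs_choiceProb_zero_sub_sub_le hk0 hθ0 hθ hd0 hη3 hdi S
      _ = 12 * k ^ 3 * U * ∑ S ∈ selected x, 1 / ((S.card : ℝ) + 1) ^ 2 := by
          rw [Finset.mul_sum]
          exact Finset.sum_congr rfl fun S _ => by ring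
      _ ≤ 12 * k ^ 3 * U * (33 * N / (n : ℝ) ^ 2) := by
          gcongr
          exact hx.selection.sum_inv_sq_le hn
      _ = _ := by ring
  have hTge := hx.selection.sum_ratio_ge hn hk0 hθ hη3
  set W := ∑ S ∈ selected x, T S with hW
  have hmean : |mean (θ + d)| ≤ 2 * k := by
    rw [mean_add]
    have h1 : |mean θ| ≤ k := by
      unfold mean
      rw [abs_div, abs_of_pos (by positivity : (0 : ℝ) < (n : ℝ) + 1), div_le_iff₀ (by positivity)]
      calc |∑ i, θ i| ≤ ∑ i, |θ i| := Finset.abs_sum_le_sum_abs _ _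
        _ ≤ ∑ _i : Fin (n + 1), k := Finset.sum_le_sum fun i _ => hθ.abs_apply_le hk i
        _ = _ := by simp [mul_comm]
    calc |mean θ + mean d| ≤ |mean θ| + |mean d| := abs_add_le _ _
      _ ≤ _ := by linarith
  have hmain : |Real.exp (mean d) - 1| * W ≤
      γ + 2 * lam * k + 396 * k ^ 3 * N / (n : ℝ) ^ 2 * U := by
    have hW0 : 0 ≤ W := le_trans (by positivity) hTge
    have h1 : |(Real.exp (mean d) - 1) * W| = |Real.exp (mean d) - 1| * W := by
      rw [abs_mul, abs_of_nonneg hW0]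
    rw [hsum] at hrem
    have h2 := abs_le.1 hrem
    have h3 := abs_le.1 (hx.noise_le 0)
    have h4 : |lam * mean (θ + d)| ≤ lam * (2 * k) := by
      rw [abs_mul, abs_of_nonneg hlam]
      exact mul_le_mul_of_nonneg_left hmean hlam
    have h5 := abs_le.1 h4
    rw [← h1]
    exact abs_le.2 ⟨by linarith, by linarith⟩
  have hhalf := abs_le_two_mul_abs_exp_sub_one hm
  set G := γ + 2 * lam * k + 396 * k ^ 3 * N / (n : ℝ) ^ 2 * U with hG
  have hstep : |mean d| * (N / (48 * k ^ 3 * ((n : ℝ) + 1))) ≤ 2 * G := by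
    calc _ ≤ (2 * |Real.exp (mean d) - 1|) * W :=
          mul_le_mul hhalf hTge (by positivity) (by positivity)
      _ ≤ 2 * G := by linarith
  -- dividing by the total weight of the main term
  have hfin : |mean d| ≤ 96 * k ^ 3 * ((n : ℝ) + 1) / N * G := by
    calc |mean d| = |mean d| * (N / (48 * k ^ 3 * ((n : ℝ) + 1))) *
          (48 * k ^ 3 * ((n : ℝ) + 1) / N) := by field_simp
      _ ≤ 2 * G * (48 * k ^ 3 * ((n : ℝ) + 1) / N) := by gcongr
      _ = _ := by ring
  refine hfin.trans ?_
  rw [hG]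
  gcongr

/-- The deterministic error bound. The radius `ρ` is twice the value at which curvature and
gradient balance in `IsGoodSample.sqrt_spread_sub_le`. -/
theorem IsGoodSample.norm_sub_le (hn : 1 ≤ n) (hL : 1 ≤ L) {N γ k lam : ℝ} (hk : 1 ≤ k)
    (hN : 0 < N) (hlam : 0 < lam) {θ : Score n} (hθ0 : θ 0 = 0) (hθ : IsScoreBound k θ)
    {x : Sample n L} (hx : IsGoodSample N γ θ x) {η : Score n} (hη : IsPenalizedMLE lam x η)
    {ρ : ℝ} (hρ : ρ = 128 * k ^ 4 * (((n : ℝ) + 1) * Real.sqrt ((n : ℝ) + 1)) *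
      (γ + 2 * lam * k) / N) (hρ1 : ρ ≤ 1 / 2) :
    ‖η - θ‖ ≤ 152066 * k ^ 6 * ρ := by
  have hk0 : 0 < k := by linarith
  have hn0 : (1 : ℝ) ≤ n := by exact_mod_cast hn
  have hγ : 0 ≤ γ := (abs_nonneg _).trans (hx.noise_le 0)
  set s := Real.sqrt ((n : ℝ) + 1) with hs
  have hs0 : 0 < s := Real.sqrt_pos.2 (by positivity)
  have hs2 : s ^ 2 = (n : ℝ) + 1 := Real.sq_sqrt (by positivity)
  set G := γ + 2 * lam * k with hG
  have hG0 : 0 < G := by positivity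
  have hρ0 : 0 < ρ := by rw [hρ]; positivity
  have hr : Real.sqrt (spread (η - θ)) ≤ ρ := by
    refine hx.sqrt_spread_sub_le hL hk hlam.le hθ0 hθ hρ0 hρ1 ?_ hη
    have h1 : N / (64 * k ^ 4 * ((n : ℝ) + 1)) * ρ = 2 * (s * G) := by
      rw [hρ]
      field_simp
      norm_num
    rw [h1]
    have h2 : s * (γ + lam * k) ≤ s * G := by
      rw [hG]
      gcongr
      linarith [mul_pos hlam hk0]
    have h3 : 0 < s * G := by positivity
    linarith
  have hm := hx.abs_mean_sub_le hn hL hk hN hlam.le hθ0 hθ hη (hr.trans hρ1)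
  rw [← hs, ← hG] at hm
  set r := Real.sqrt (spread (η - θ)) with hrdef
  have hr0 : 0 ≤ r := Real.sqrt_nonneg _
  have hsm : s * |mean (η - θ)| ≤ ρ + 152064 * k ^ 6 * ρ := by
    have h1 : s * |mean (η - θ)| ≤ 96 * k ^ 3 * (((n : ℝ) + 1) * s) * G / N +
        38016 * k ^ 6 * (((n : ℝ) + 1) ^ 2 / (n : ℝ) ^ 2) * r := by
      calc s * |mean (η - θ)| ≤ s * (96 * k ^ 3 * ((n : ℝ) + 1) / N *
            (G + 396 * k ^ 3 * N / (n : ℝ) ^ 2 * (s * r))) := by gcongr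
        _ = 96 * k ^ 3 * (((n : ℝ) + 1) * s) * G / N +
            38016 * k ^ 6 * (((n : ℝ) + 1) * s ^ 2 / (n : ℝ) ^ 2) * r := by
            field_simp
            ring
        _ = _ := by rw [hs2]; ring
    have h2 : 96 * k ^ 3 * (((n : ℝ) + 1) * s) * G / N ≤ ρ := by
      rw [hρ]
      have h3 : k ^ 3 ≤ k ^ 4 := pow_le_pow_right₀ hk (by norm_num)
      gcongr
      norm_num
    have h4 : ((n : ℝ) + 1) ^ 2 / (n : ℝ) ^ 2 ≤ 4 := by
      rw [div_le_iff₀ (by positivity)]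
      calc ((n : ℝ) + 1) ^ 2 ≤ (2 * n) ^ 2 := by
            gcongr
            linarith
        _ = _ := by ring
    have h5 : 38016 * k ^ 6 * (((n : ℝ) + 1) ^ 2 / (n : ℝ) ^ 2) * r ≤ 38016 * k ^ 6 * 4 * ρ := by
      gcongr
    linarith
  have hnorm : ‖η - θ‖ ≤ r + s * |mean (η - θ)| := by
    refine abs_le_of_sq_le_sq' ?_ (by positivity) |>.2
    rw [norm_sq_eq_spread_add, ← Real.sq_sqrt (spread_nonneg (η - θ)), ← hrdef, ← hs2]
    have h6 := sq_abs (mean (η - θ))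
    have h7 : 0 ≤ r * (s * |mean (η - θ)|) := by positivity
    have h8 : (r + s * |mean (η - θ)|) ^ 2 =
        r ^ 2 + s ^ 2 * |mean (η - θ)| ^ 2 + 2 * (r * (s * |mean (η - θ)|)) := by ring
    rw [h8, h6]
    linarith
  have h8 : ρ ≤ k ^ 6 * ρ := le_mul_of_one_le_left hρ0.le (one_le_pow₀ hk)
  linarith

end NoPurchase

/-! ### Rates and the failure probability -/

theorem exists_poly_mul_geometric_le (m : ℕ) {r : ℝ} (hr0 : 0 ≤ r) (hr1 : r < 1) :
    ∃ B : ℝ, 0 < B ∧ ∀ n : ℕ, (n : ℝ) ^ m * r ^ n ≤ B := by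
  have h := tendsto_pow_const_mul_const_pow_of_abs_lt_one m (r := r)
    (by rwa [abs_of_nonneg hr0])
  obtain ⟨B, hB⟩ := h.bddAbove_range
  exact ⟨max B 1, by positivity, fun n => (hB ⟨n, rfl⟩).trans (le_max_left _ _)⟩

/-- The failure probability of `IsGoodSample`. The constant `768 = 64 * 12` turns the tail `exp (-N
/ 64)` into `n⁻¹²`. -/
theorem failure_bound_le {n : ℕ} {N B : ℝ} (hn : (1 : ℝ) ≤ n) (hlog : 0 ≤ Real.log n)
    (hN : 768 * n * Real.log n ≤ N) (hB : (n : ℝ) ^ 12 * (337 / 384 : ℝ) ^ n ≤ B) :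
    (((n : ℝ) + 1) ^ 2 + 1) * Real.exp (-(N / 64)) + (n : ℝ) ^ 2 * (337 / 384 : ℝ) ^ n +
      ((n : ℝ) + 1) * (2 * Real.exp (-(12 * Real.log n))) ≤ (B + 9) / (n : ℝ) ^ 10 := by
  have hn0 : (0 : ℝ) < n := by linarith
  have h1 : Real.exp (-(12 * Real.log n)) = 1 / (n : ℝ) ^ 12 := by
    have h := Real.exp_nat_mul (Real.log n) 12
    rw [Real.exp_log hn0] at h
    rw [Real.exp_neg, one_div, ← h]
    norm_num
  have h2 : Real.exp (-(N / 64)) ≤ 1 / (n : ℝ) ^ 12 := by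
    rw [← h1]
    refine Real.exp_le_exp.2 ?_
    have := mul_le_mul_of_nonneg_right hn hlog
    linarith
  have h4 : (((n : ℝ) + 1) ^ 2 + 1) * Real.exp (-(N / 64)) ≤ 5 / (n : ℝ) ^ 10 := by
    calc _ ≤ (5 * (n : ℝ) ^ 2) * (1 / (n : ℝ) ^ 12) :=
          mul_le_mul (by nlinarith) h2 (Real.exp_pos _).le (by positivity)
      _ = _ := by field_simp
  have h5 : ((n : ℝ) + 1) * (2 * Real.exp (-(12 * Real.log n))) ≤ 4 / (n : ℝ) ^ 10 := by
    rw [h1]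
    calc _ ≤ (2 * (n : ℝ) ^ 2) * (2 * (1 / (n : ℝ) ^ 12)) :=
          mul_le_mul_of_nonneg_right (by nlinarith) (by positivity)
      _ = _ := by field_simp; norm_num
  have h6 : (n : ℝ) ^ 2 * (337 / 384 : ℝ) ^ n ≤ B / (n : ℝ) ^ 10 := by
    rw [le_div_iff₀ (by positivity)]
    calc _ = (n : ℝ) ^ 12 * (337 / 384 : ℝ) ^ n := by ring
      _ ≤ B := hB
  calc _ ≤ 5 / (n : ℝ) ^ 10 + B / (n : ℝ) ^ 10 + 4 / (n : ℝ) ^ 10 := by gcongr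
    _ = _ := by ring

/-- The noise level in one coordinate, rescaled to the error rate in norm. -/
theorem rate_eq {n L : ℕ} (hn : 1 ≤ n) (hL : 1 ≤ L) {N ℓ : ℝ} (hN : 0 < N) (hℓ : 0 ≤ ℓ) :
    n * Real.sqrt n * Real.sqrt (N * ℓ / (n * L)) / N = n * Real.sqrt (ℓ / (N * L)) := by
  have hn1 : (1 : ℝ) ≤ n := by exact_mod_cast hn
  have hL1 : (1 : ℝ) ≤ L := by exact_mod_cast hL
  have h1 : N * ℓ / (n * L) = N ^ 2 * (ℓ / (N * L)) / n := by
    field_simp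
  rw [h1, Real.sqrt_div (by positivity), Real.sqrt_mul (by positivity), Real.sqrt_sq hN.le]
  have : 0 < Real.sqrt n := Real.sqrt_pos.2 (by linarith)
  field_simp

theorem add_one_mul_sqrt_le {t : ℝ} (ht : 1 ≤ t) :
    (t + 1) * Real.sqrt (t + 1) ≤ 3 * (t * Real.sqrt t) := by
  have h2 : Real.sqrt (t + 1) ≤ 3 / 2 * Real.sqrt t := by
    have h3 : Real.sqrt (t + 1) ≤ Real.sqrt ((3 / 2) ^ 2 * t) :=
      Real.sqrt_le_sqrt (by linarith)
    rwa [Real.sqrt_mul (by positivity), Real.sqrt_sq (by norm_num)] at h3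
  calc (t + 1) * Real.sqrt (t + 1) ≤ (2 * t) * (3 / 2 * Real.sqrt t) := by
        gcongr
        linarith
    _ = _ := by ring

end MNL

/-! ### The error bound -/

theorem theorem2 (κ a b : ℝ) (ha : 0 < a) (hab : a ≤ b) :
    ∃ C c K M : ℝ, 0 < C ∧ 0 < c ∧ 0 < K ∧ 0 < M ∧
      ∀ (n L : ℕ) (p : unitInterval) (θs : MNL.Score n) (lam : ℝ),
        1 ≤ n → 1 ≤ L →
        θs 0 = 0 → MNL.condNumber θs ≤ κ →
        0 < lam →
        a * Real.sqrt (2 ^ n * (p : ℝ) * Real.log n / (n * L)) ≤ lam →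
        lam ≤ b * Real.sqrt (2 ^ n * (p : ℝ) * Real.log n / (n * L)) →
        C * n * Real.log n ≤ 2 ^ n * (p : ℝ) →
        n * Real.sqrt (Real.log n / (2 ^ n * (p : ℝ) * L)) ≤ c →
        (∀ x : MNL.Sample n L, ∃! θ : MNL.Score n, MNL.IsPenalizedMLE lam x θ) ∧
        1 - M / (n : ℝ) ^ 10 ≤
          (MNL.dataLaw n L p θs).real
            {x | ∀ θ : MNL.Score n, MNL.IsPenalizedMLE lam x θ →
              ‖θ - θs‖ ≤ K * (n * Real.sqrt (Real.log n / (2 ^ n * (p : ℝ) * L)))} := by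
  open MNL in
  have hb : 0 < b := ha.trans_le hab
  -- the hypotheses force `1 ≤ κ`, but the constants must be positive for every `κ`
  set k : ℝ := max κ 1 with hkdef
  have hk : 1 ≤ k := le_max_right _ _
  have hk0 : 0 < k := by linarith
  obtain ⟨B, hB0, hB⟩ := exists_poly_mul_geometric_le 12 (r := 337 / 384) (by norm_num)
    (by norm_num)
  set K₁ : ℝ := 384 * k ^ 5 * (21 + 2 * b) with hK₁
  have hK₁0 : 0 < K₁ := by positivity
  refine ⟨768, 1 / (2 * K₁), 152066 * k ^ 6 * K₁, B + 9, by norm_num, by positivity,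
    by positivity, by positivity, ?_⟩
  intro n L p θs lam hn hL hθ0 hcond hlam _ hlamb hC hc
  refine ⟨fun x => existsUnique_isPenalizedMLE hL hlam x, ?_⟩
  have hn1 : (1 : ℝ) ≤ n := by exact_mod_cast hn
  have hL1 : (1 : ℝ) ≤ L := by exact_mod_cast hL
  set N : ℝ := 2 ^ n * (p : ℝ) with hN
  set τ := Real.sqrt (N * Real.log n / (n * L)) with hτ
  -- for `n = 1` one has `τ = 0`, which contradicts `0 < lam ≤ b * τ`
  have hτ0 : 0 < τ := by
    by_contra h
    have : b * τ ≤ 0 := mul_nonpos_of_nonneg_of_nonpos hb.le (not_lt.1 h)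
    linarith
  have hNlog : 0 < N * Real.log n := by
    have h1 : 0 < N * Real.log n / (n * L) := Real.sqrt_pos.1 hτ0
    have h2 := mul_pos h1 (by positivity : (0 : ℝ) < n * L)
    rwa [div_mul_cancel₀ _ (by positivity)] at h2
  have hlog0 : 0 ≤ Real.log n := Real.log_nonneg hn1
  have hlog : 0 < Real.log n := lt_of_le_of_ne hlog0 fun h => by simp [← h] at hNlog
  have hN0 : 0 < N := (pos_iff_pos_of_mul_pos hNlog).2 hlog
  have hp0 : 0 < (p : ℝ) := by
    by_contra h
    have : N ≤ 0 := mul_nonpos_of_nonneg_of_nonpos (by positivity) (not_lt.1 h)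
    linarith
  set R := n * Real.sqrt (Real.log n / (N * L)) with hR
  have hR0 : 0 ≤ R := by positivity
  have hRτ : n * Real.sqrt n * τ / N = R := rate_eq hn hL hN0 hlog0
  have hθ : IsScoreBound k θs := by
    have h1 := isScoreBound_of_condNumber_le hθ0 hcond
    have hκ : 0 < κ := (Real.exp_pos _).trans_le (h1 0).2
    exact h1.mono hκ (le_max_left _ _)
  have hprob := measureReal_not_isGoodSample_le hn hL p hp0 hk hθ
    (ℓ := 12 * Real.log n) (by positivity) (by
      rw [← hN]
      linarith [mul_nonneg (by linarith : (0 : ℝ) ≤ n) hlog0])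
  rw [← hN] at hprob
  set γ := 6 * k * Real.sqrt (N * (12 * Real.log n) / (n * L)) with hγ
  have hγτ : γ ≤ 21 * k * τ := by
    have h1 : N * (12 * Real.log n) / (n * L) = 12 * (N * Real.log n / (n * L)) := by ring
    -- `6 * √12 ≤ 21`
    have h2 : Real.sqrt 12 ≤ 7 / 2 := Real.sqrt_le_iff.2 (by norm_num)
    rw [hγ, h1, Real.sqrt_mul (by norm_num), ← hτ]
    linarith [mul_le_mul_of_nonneg_right h2 (mul_pos hk0 hτ0).le]
  have hgood : ∀ x : Sample n L, IsGoodSample N γ θs x → ∀ θ : Score n, IsPenalizedMLE lam x θ →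
      ‖θ - θs‖ ≤ 152066 * k ^ 6 * K₁ * R := by
    intro x hx θ hθmle
    have hρ : 128 * k ^ 4 * (((n : ℝ) + 1) * Real.sqrt ((n : ℝ) + 1)) *
        (γ + 2 * lam * k) / N ≤ K₁ * R := by
      have h1 := add_one_mul_sqrt_le hn1
      have h4 : γ + 2 * lam * k ≤ k * (21 + 2 * b) * τ := by
        linarith [mul_le_mul_of_nonneg_right hlamb hk0.le]
      have hγ0 : 0 ≤ γ := by positivity
      calc _ ≤ 128 * k ^ 4 * (3 * (n * Real.sqrt n)) * (k * (21 + 2 * b) * τ) / N := by gcongr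
        _ = K₁ * (n * Real.sqrt n * τ / N) := by rw [hK₁]; ring
        _ = K₁ * R := by rw [hRτ]
    have hρ1 : K₁ * R ≤ 1 / 2 := by
      calc K₁ * R ≤ K₁ * (1 / (2 * K₁)) := by gcongr
        _ = 1 / 2 := by field_simp
    refine (hx.norm_sub_le hn hL hk hN0 hlam hθ0 hθ hθmle rfl (hρ.trans hρ1)).trans ?_
    rw [mul_assoc (152066 * k ^ 6)]
    gcongr
  have htail := failure_bound_le hn1 hlog0 hC (hB n)
  have hmeas : MeasurableSet {x : Sample n L | IsGoodSample N γ θs x} :=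
    (Set.toFinite _).measurableSet
  have hcompl := probReal_compl_eq_one_sub (μ := dataLaw n L p θs) hmeas
  have hset : {x : Sample n L | IsGoodSample N γ θs x}ᶜ =
      {x | ¬ IsGoodSample N γ θs x} := rfl
  rw [hset] at hcompl
  have hmono : (dataLaw n L p θs).real {x | IsGoodSample N γ θs x} ≤ (dataLaw n L p θs).real
      {x | ∀ θ : Score n, IsPenalizedMLE lam x θ → ‖θ - θs‖ ≤ 152066 * k ^ 6 * K₁ * R} :=
    measureReal_mono fun x hx => hgood x hx
  linarith
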